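/- Let $\mathbb K$ be a field of characteristic different from $2$, let $V$ be a $2n$-dimensional vector space over $\mathbb K$ with a non-degenerate skew-symmetric form $(\,,\,)$, and let $\mathfrak{sp}_{2n}=\mathfrak{sp}(V)\subset\mathfrak{gl}(V)$ be the Lie algebra of all $\xi$ with $(\xi v,w)=-(v,\xi w)$ for all $v,w\in V$. For a finite-dimensional Lie algebra $\mathfrak q$ and $\gamma\in\mathfrak q^*$ write $\mathfrak q_\gamma=\{x\in\mathfrak q:\gamma([x,y])=0\ \text{for all } y\in\mathfrak q\}$ and $\operatorname{ind}\mathfrak q=\min_{\gamma\in\mathfrak q^*}\dim\mathfrak q_\gamma$. Let $e\in\mathfrak{sp}_{2n}$ be nilpotent, and let $\mathfrak z(e)$ and $\mathfrak z_{\mathfrak{gl}}(e)$ be its centralisers in $\mathfrak{sp}_{2n}$ and in $\mathfrak{gl}(V)$. (1) There are generators $w_1,\dots,w_k$ of the Jordan blocks of $e$, that is, vectors and integers $d_i\ge 0$ such that $e^{d_i+1}w_i=0$ and the vectors $e^sw_i$ ($1\le i\le k$, $0\le s\le d_i$) form a basis of $V$, and an involution $i\mapsto i'$ of $\{1,\dots,k\}$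 with $d_{i'}=d_i$, such that $i'=i$ if and only if the $i$-th block (of dimension $d_i+1$) is even-dimensional, and such that the space of the $i$-th block is orthogonal to the space of the $j$-th block whenever $j\ne i'$. (2) Fix any such generators. For $\varphi\in\mathfrak z_{\mathfrak{gl}}(e)$ write $\varphi(w_i)=\sum_{j,s}c_i^{j,s}(\varphi)\,e^sw_j$. Let $a_1,\dots,a_k\in\mathbb K$ be pairwise distinct and non-zero, with $a_{i'}=-a_i$ whenever the $i$-th block is odd-dimensional. Let $\alpha\in\mathfrak z_{\mathfrak{gl}}(e)^*$ be given by $\alpha(\varphi)=\sum_{i=1}^k a_i\,c_i^{i,d_i}(\varphi)$, and let $\tilde\alpha$ be its restriction to $\mathfrak z(e)$. Then $$\mathfrak z(e)_{\tilde\alpha}=\mathfrak z_{\mathfrak{gl}}(e)_\alpha\cap\mathfrak{sp}_{2n}\quad\text{and}\quad \dim\mathfrak z(e)_{\tilde\alpha}=n.$$ (3) If $\mathbb K$ has at least $k$ elements, where $k$ is the number of Jordan blocks of $e$, then $\operatorname{ind}\mathfrak z(e)=n$. Moreover $\operatorname{rk}\mathfrak{sp}_{2n}=n$, so that $\operatorname{ind}\mathfrak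 z(e)=\operatorname{rk}\mathfrak{sp}_{2n}$. -/

import Mathlib

attribute [local instance 100] LieRing.ofAssociativeRing

namespace ClassicalIndex

open Module

section LieGeneral

variable (K : Type*) {L : Type*} [CommRing K] [LieRing L] [LieAlgebra K L]

/-- The centraliser of an element `x` of a Lie algebra. -/
def centralizer (x : L) : LieSubalgebra K L where
  carrier := {y | ⁅x, y⁆ = 0}
  zero_mem' := lie_zero x
  add_mem' := fun {a b} ha hb => by
    have ha' : ⁅x, a⁆ = 0 := ha
    have hb' : ⁅x, b⁆ = 0 := hb
    change ⁅x, a + b⁆ = 0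
    rw [lie_add, ha', hb', add_zero]
  smul_mem' := fun c a ha => by
    have ha' : ⁅x, a⁆ = 0 := ha
    change ⁅x, c • a⁆ = 0
    rw [lie_smul, ha', smul_zero]
  lie_mem' := fun {a b} ha hb => by
    have ha' : ⁅x, a⁆ = 0 := ha
    have hb' : ⁅x, b⁆ = 0 := hb
    change ⁅x, ⁅a, b⁆⁆ = 0
    rw [leibniz_lie, ha', hb', zero_lie, lie_zero, add_zero]

variable {K}

theorem mem_centralizer {x y : L} : y ∈ centralizer K x ↔ ⁅x, y⁆ = 0 := Iff.rfl

/-- The stabiliser of a covector `α` for the coadjoint representation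
`(x · α)(y) = -α ⁅x, y⁆`. -/
def coadjointStabilizer (α : Dual K L) : LieSubalgebra K L where
  carrier := {x | ∀ y, α ⁅x, y⁆ = 0}
  zero_mem' := fun y => by rw [zero_lie, map_zero]
  add_mem' := fun {a b} ha hb y => by rw [add_lie, map_add, ha y, hb y, add_zero]
  smul_mem' := fun c a ha y => by rw [smul_lie, map_smul, ha y, smul_zero]
  lie_mem' := fun {a b} ha hb y => by
    rw [lie_lie, map_sub, ha, hb, sub_zero]

theorem mem_coadjointStabilizer {α : Dual K L} {x : L} :
    x ∈ coadjointStabilizer α ↔ ∀ y, α ⁅x, y⁆ = 0 := Iff.rfl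

theorem mem_coadjointStabilizer_iff_lie_eq_zero {α : Dual K L} {x : L} :
    x ∈ coadjointStabilizer α ↔ ⁅x, α⁆ = 0 := by
  rw [mem_coadjointStabilizer, LinearMap.ext_iff]
  simp

variable (K L) in
/-- The index of a (finite-dimensional) Lie algebra: the minimal dimension of the stabiliser of a
covector for the coadjoint representation. -/
noncomputable def index : ℕ :=
  ⨅ α : Dual K L, finrank K (coadjointStabilizer α)

end LieGeneral

section Jordan

variable {K V : Type*} [Field K] [AddCommGroup V] [Module K V]

/-- Generators `w i` of the `k` Jordan blocks of a nilpotent endomorphism `e`. The `i`-th block has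
dimension `d i + 1`, and the vectors `e ^ s (w i)` with `s ≤ d i` form a basis of `V`. -/
structure JordanGenerators (e : End K V) (k : ℕ) where
  d : Fin k → ℕ
  w : Fin k → V
  basis : Basis (Σ i, Fin (d i + 1)) K V
  basis_apply : ∀ i s, basis ⟨i, s⟩ = (e ^ (s : ℕ)) (w i)
  pow_apply_eq_zero : ∀ i, (e ^ (d i + 1)) (w i) = 0

namespace JordanGenerators

variable {e : End K V} {k : ℕ} (J : JordanGenerators e k)

/-- The coefficients `c_i^{j,s}` in `φ (w i) = ∑ j, ∑ s, c_i^{j,s} e ^ s (w j)`. -/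
noncomputable def coeff (i j : Fin k) (s : Fin (J.d j + 1)) (φ : End K V) : K :=
  J.basis.repr (φ (J.w i)) ⟨j, s⟩

/-- The covector `φ ↦ ∑ i, a i * c_i^{i, d i} φ` on the centraliser of `e` in `gl(V)`. -/
noncomputable def alpha (a : Fin k → K) : Dual K (centralizer K e) where
  toFun φ := ∑ i, a i * J.coeff i i (Fin.last (J.d i)) (φ : End K V)
  map_add' φ ψ := by simp [coeff, mul_add, Finset.sum_add_distrib]
  map_smul' c φ := by simp [coeff, Finset.mul_sum, mul_left_comm]

end JordanGenerators

/-- Generators of the Jordan blocks adapted to the skew-symmetric form `ω`: there is an involution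
`i ↦ i'` of the blocks, preserving dimensions, whose fixed points are exactly the even-dimensional
blocks, such that the space of the `i`-th block is orthogonal to that of every block except possibly
the `i'`-th. So even-dimensional blocks are orthogonal to all other blocks, while `ω` vanishes on
each odd-dimensional block, and these come in pairs. -/
structure SymplecticJordanGenerators (ω : LinearMap.BilinForm K V) (e : End K V) (k : ℕ)
    extends JordanGenerators e k where
  pair : Fin k → Fin k
  pair_pair : ∀ i, pair (pair i) = i
  pair_eq_self_iff : ∀ i, pair i = i ↔ Even (d i + 1)
  d_pair : ∀ i, d (pair i) = d i
  orthogonal : ∀ i j, j ≠ pair i → ∀ s t : ℕ, ω ((e ^ s) (w i)) ((e ^ t) (w j)) = 0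

/-- The symplectic Lie algebra `sp(V)` of the form `ω`, as a Lie subalgebra of `gl(V)`. -/
abbrev sp (ω : LinearMap.BilinForm K V) : LieSubalgebra K (End K V) :=
  skewAdjointLieSubalgebra ω

theorem mem_sp {ω : LinearMap.BilinForm K V} {x : End K V} :
    x ∈ sp ω ↔ ∀ v u, ω (x v) u = - ω v (x u) := by
  change x ∈ ω.skewAdjointSubmodule ↔ _
  rw [LinearMap.mem_skewAdjointSubmodule]
  simp [LinearMap.IsSkewAdjoint, LinearMap.IsAdjointPair]

/-- The inclusion of the centraliser of `e` in `sp(V)` into its centraliser in `gl(V)`. -/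
def centralizerInclusion (ω : LinearMap.BilinForm K V) (e : sp ω) :
    centralizer K e →ₗ[K] centralizer K (e : End K V) where
  toFun x := ⟨((x : sp ω) : End K V), congrArg Subtype.val x.2⟩
  map_add' _ _ := rfl
  map_smul' _ _ := rfl

/-- The restriction to the centraliser of `e` in `sp(V)` of a covector on the centraliser of `e` in
`gl(V)`. -/
def restrictCovector (ω : LinearMap.BilinForm K V) (e : sp ω)
    (α : Dual K (centralizer K (e : End K V))) : Dual K (centralizer K e) :=
  α ∘ₗ centralizerInclusion ω e

end Jordan

end ClassicalIndex

/-!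
Let `σ` be the adjoint involution of `End V`, so that `sp(V)` is the space of its skew elements and
odd powers of elements of `sp(V)` stay in `sp(V)`.

*Lower bound for the index.* A covector on `𝔷(e) ⊆ sp(V)` has the form `y ↦ tr (b y)` with
`b ∈ sp(V)`. Let `h` be a regular nilpotent element of `sp(V)`, a shift of a symplectic basis, and
consider the curve `z = e + t b + t² h` in `sp(V)[t]`. The curves in `sp(V)[t]` of degree at
most `N` that commute with `z` have constant terms and `t ^ N`-coefficients sweeping out spaces of
the same dimension (`finrank_range_curveCoeff`), since the kernels of both maps are copies of the
space of curves of degree less than `N`. For large `N` the top coefficients include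
`h, h³, …, h ^ (2n - 1)`, from the curves `z ^ (2j + 1) t ^ r`. So the constant terms form a space
of dimension at least `n`, and comparing the terms of order zero and one shows that it lies in the
stabiliser of `tr (b ·)` (`exists_deformable_centralizer`, `le_finrank_coadjointStabilizer`). This
works over every field of characteristic different from two.

*Adapted generators.* Take the largest `d` with `e ^ d ≠ 0`. The form `ω (e ^ d v) w` is symmetric
for odd `d`, and then some `v` with `ω (e ^ d v) v ≠ 0` generates a block on which `ω` is
non-degenerate. It is alternating for even `d`, and then a pair `v`, `w` with
`ω (e ^ d v) w ≠ 0` can be modified so that both blocks become isotropic (`exists_isotropic`). The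
construction is repeated in the orthogonal complement (`IsAdapted.exists_extension`).

*The stabiliser of `α`.* Testing against elementary endomorphisms `w j ↦ e ^ t (w i)` shows that the
stabiliser of `α` in the centraliser in `gl(V)` is block-diagonal
(`coordAt_eq_zero_of_mem_stabilizer`). Passing to the adjoint replaces `p (e)` on the `i`-th block
by `p (-e)` on the partner block, so `α ∘ σ = -α` (`alpha_adj`), which gives the comparison of the
stabilisers (`map_stabilizer_restrictCovector`). The skew-adjoint block-diagonal elements form a
space of dimension at most `n` (`two_mul_finrank_skewCoeffs_le`), and the lower bound above gives
equality. For the index over small fields one uses that zero may occur among the `a i` if all blocks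
have the same dimension (`exists_coefficients`).

*The rank.* The coefficients of the generic characteristic polynomial are tested on points of
`F ⊗ sp(V)` for the field `F` of rational functions, which is infinite. The deformation argument
with `b = 0` bounds centralisers in `F ⊗ sp(V)` from below by `n`, and a diagonal element with
distinct eigenvalues attains the bound with semisimple adjoint action (`rank_sp`).
-/

namespace ClassicalIndex

open Module

/-! ### Deforming a pair of skew elements -/

section Curve

open Polynomial

variable {K R : Type*} [Field K] [Ring R] [Algebra K R] (σ : R →ₗ[K] R)

/-- The space of elements that are skew for the linear map `σ`; in the applications `σ` is an
anti-involution. -/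
def skew : Submodule K R := LinearMap.ker (σ + LinearMap.id)

variable {σ}

theorem mem_skew {x : R} : x ∈ skew σ ↔ σ x = -x := by
  simp [skew, LinearMap.mem_ker, add_eq_zero_iff_eq_neg]

/-- The coefficients of the `m`-th power of a polynomial with skew coefficients are
skew for odd `m` and fixed by `σ` for even `m`. -/
theorem map_coeff_pow_of_skew (h1 : σ 1 = 1) (hmul : ∀ x y, σ (x * y) = σ y * σ x) {z : R[X]}
    (hz : ∀ i, z.coeff i ∈ skew σ) (m i : ℕ) :
    σ ((z ^ m).coeff i) = (-1) ^ m * (z ^ m).coeff i := by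
  induction m generalizing i with
  | zero => by_cases hi : i = 0 <;> simp [coeff_one, hi, h1]
  | succ m ih =>
    conv_lhs => rw [pow_succ, coeff_mul, map_sum]
    conv_rhs => rw [pow_succ' z, coeff_mul, ← Finset.Nat.sum_antidiagonal_swap, Finset.mul_sum]
    refine Finset.sum_congr rfl fun p _ => ?_
    rw [hmul, ih, mem_skew.1 (hz _), Prod.fst_swap, Prod.snd_swap, pow_succ]
    rcases neg_one_pow_eq_or R m with h | h <;> simp [h]

variable (σ) in
/-- The curves in the space of skew elements, of degree less than `N`, that commute with the
curve `z`. -/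
def commutingCurves (z : R[X]) (N : ℕ) : Submodule K R[X] where
  carrier := {p | (∀ i, p.coeff i ∈ skew σ) ∧ (∀ i, N ≤ i → p.coeff i = 0) ∧ z * p = p * z}
  zero_mem' := by simp
  add_mem' := by
    rintro p q ⟨hp1, hp2, hp3⟩ ⟨hq1, hq2, hq3⟩
    refine ⟨fun i => ?_, fun i hi => ?_, ?_⟩
    · rw [coeff_add]; exact add_mem (hp1 i) (hq1 i)
    · rw [coeff_add, hp2 i hi, hq2 i hi, add_zero]
    · rw [mul_add, add_mul, hp3, hq3]
  smul_mem' := by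
    rintro c p ⟨hp1, hp2, hp3⟩
    refine ⟨fun i => ?_, fun i hi => ?_, ?_⟩
    · rw [coeff_smul]; exact (skew σ).smul_mem c (hp1 i)
    · rw [coeff_smul, hp2 i hi, smul_zero]
    · rw [mul_smul_comm, smul_mul_assoc, hp3]

theorem mem_commutingCurves {z p : R[X]} {N : ℕ} : p ∈ commutingCurves σ z N ↔
    (∀ i, p.coeff i ∈ skew σ) ∧ (∀ i, N ≤ i → p.coeff i = 0) ∧ z * p = p * z := Iff.rfl

instance [FiniteDimensional K R] (z : R[X]) (N : ℕ) :
    FiniteDimensional K (commutingCurves σ z N) := by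
  let f : commutingCurves σ z N →ₗ[K] (Fin N → R) :=
    { toFun := fun p i => (p : R[X]).coeff i
      map_add' := fun p q => by ext; simp
      map_smul' := fun c p => by ext; simp }
  refine FiniteDimensional.of_injective f fun p q hpq => Subtype.ext ?_
  ext i
  by_cases hi : i < N
  · exact congrFun hpq ⟨i, hi⟩
  · rw [(mem_commutingCurves.1 p.2).2.1 i (not_lt.1 hi),
      (mem_commutingCurves.1 q.2).2.1 i (not_lt.1 hi)]

variable (σ) in
/-- The `i`-th coefficient of a curve, as a linear map. -/
noncomputable def curveCoeff (z : R[X]) (N i : ℕ) : commutingCurves σ z N →ₗ[K] R :=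
  ((lcoeff R i).restrictScalars K).domRestrict (commutingCurves σ z N)

@[simp] theorem curveCoeff_apply (z : R[X]) (N i : ℕ) (p : commutingCurves σ z N) :
    curveCoeff σ z N i p = (p : R[X]).coeff i := rfl

/-- Curves without constant term and curves without top term both form a copy of the space of
curves of smaller degree; hence constant terms and top terms sweep out spaces of the same
dimension. -/
theorem finrank_range_curveCoeff [FiniteDimensional K R] (z : R[X]) (N : ℕ) :
    finrank K (LinearMap.range (curveCoeff σ z (N + 1) 0)) =
      finrank K (LinearMap.range (curveCoeff σ z (N + 1) N)) := by
  have h0 : finrank K (LinearMap.ker (curveCoeff σ z (N + 1) 0)) =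
      finrank K (commutingCurves σ z N) := by
    symm
    refine LinearEquiv.finrank_eq (LinearEquiv.ofBijective
      (LinearMap.codRestrict _ (LinearMap.codRestrict _
        ({ toFun := fun p => X * (p : R[X])
           map_add' := fun p q => by simp [mul_add]
           map_smul' := fun c p => by simp } : commutingCurves σ z N →ₗ[K] R[X]) ?_) ?_) ⟨?_, ?_⟩)
    · rintro ⟨p, hp1, hp2, hp3⟩
      refine ⟨fun i => ?_, fun i hi => ?_, ?_⟩
      · cases i with
        | zero => simp
        | succ i => simpa using hp1 i
      · obtain ⟨i, rfl⟩ := Nat.exists_eq_add_of_le' (Nat.one_le_of_lt hi)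
        simpa using hp2 i (by omega)
      · simp only [LinearMap.coe_mk, AddHom.coe_mk]
        rw [← mul_assoc, ← X_mul, mul_assoc, hp3, mul_assoc]
    · intro p
      simp [LinearMap.mem_ker]
    · intro p q hpq
      have h : X * (p : R[X]) = X * (q : R[X]) :=
        congrArg Subtype.val (congrArg Subtype.val hpq :)
      refine Subtype.ext ?_
      ext i
      simpa using congrArg (fun r => coeff r (i + 1)) h
    · rintro ⟨⟨p, hp1, hp2, hp3⟩, hp0⟩
      have hp0' : p.coeff 0 = 0 := hp0
      have hX : X * divX p = p := by
        conv_rhs => rw [← X_mul_divX_add p, hp0', C_0, add_zero]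
      refine ⟨⟨divX p, fun i => ?_, fun i hi => ?_, ?_⟩, ?_⟩
      · rw [coeff_divX]; exact hp1 _
      · rw [coeff_divX]; exact hp2 _ (by omega)
      · have : X * (z * divX p) = X * (divX p * z) := by
          rw [← mul_assoc, X_mul, mul_assoc, hX, hp3, ← mul_assoc, hX]
        ext i
        simpa using congrArg (fun r => coeff r (i + 1)) this
      · exact Subtype.ext (Subtype.ext hX)
  have h1 : finrank K (LinearMap.ker (curveCoeff σ z (N + 1) N)) =
      finrank K (commutingCurves σ z N) := by
    refine LinearEquiv.finrank_eq (LinearEquiv.ofBijective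
      (LinearMap.codRestrict _ ((commutingCurves σ z (N + 1)).subtype ∘ₗ
        (LinearMap.ker (curveCoeff σ z (N + 1) N)).subtype) ?_) ⟨?_, ?_⟩)
    · rintro ⟨⟨p, hp1, hp2, hp3⟩, hp⟩
      refine ⟨hp1, fun i hi => ?_, hp3⟩
      rcases hi.eq_or_lt with rfl | hi
      · exact hp
      · exact hp2 i hi
    · intro p q hpq
      exact Subtype.ext (Subtype.ext (congrArg Subtype.val hpq :))
    · rintro ⟨p, hp1, hp2, hp3⟩
      exact ⟨⟨⟨p, hp1, fun i hi => hp2 i (by omega), hp3⟩, hp2 N le_rfl⟩, rfl⟩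
  have e0 := LinearMap.finrank_range_add_finrank_ker (curveCoeff σ z (N + 1) 0)
  have e1 := LinearMap.finrank_range_add_finrank_ker (curveCoeff σ z (N + 1) N)
  omega

/-- If there is a skew element with `n` linearly independent odd powers, then for all skew `e` and
`b` there is an at least `n`-dimensional space of skew elements that commute with `e` and extend
to first order to a curve of skew elements commuting with the curve `e + t b`. -/
theorem exists_deformable_centralizer [FiniteDimensional K R] (h1 : σ 1 = 1)
    (hmul : ∀ x y, σ (x * y) = σ y * σ x) {n : ℕ} {h : R} (hh : h ∈ skew σ)
    (hind : LinearIndependent K fun j : Fin n => h ^ (2 * (j : ℕ) + 1))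
    {e b : R} (he : e ∈ skew σ) (hb : b ∈ skew σ) :
    ∃ W : Submodule K R, n ≤ finrank K W ∧ ∀ x ∈ W, x ∈ skew σ ∧ e * x = x * e ∧
      ∃ y ∈ skew σ, e * y + b * x = y * e + x * b := by
  -- The quadratic term makes the odd powers of `z` independent without affecting first order terms.
  set z : R[X] := C e + C b * X + C h * X ^ 2 with hz
  have hz0 : z.coeff 0 = e := by simp [hz]
  have hz1 : z.coeff 1 = b := by simp [hz, coeff_X_pow, coeff_C]
  have hz2 : z.coeff 2 = h := by simp [hz]
  have hzdeg : z.natDegree ≤ 2 := by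
    rw [hz]; compute_degree
  have hzS : ∀ i, z.coeff i ∈ skew σ := by
    intro i
    rcases i with _ | _ | _ | i
    · rwa [hz0]
    · rwa [zero_add, hz1]
    · rwa [zero_add, hz2]
    · rw [coeff_eq_zero_of_natDegree_lt (by omega)]
      exact zero_mem _
  set N := 4 * n
  refine ⟨LinearMap.range (curveCoeff σ z (N + 1) 0), ?_, ?_⟩
  · rw [finrank_range_curveCoeff]
    have hmem : ∀ j : Fin n,
        h ^ (2 * (j : ℕ) + 1) ∈ LinearMap.range (curveCoeff σ z (N + 1) N) := by
      intro j
      set m := 2 * (j : ℕ) + 1 with hm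
      have hmN : m * 2 ≤ N := by omega
      have hco : ∀ i, (z ^ m * X ^ (N - m * 2)).coeff i =
          if N - m * 2 ≤ i then (z ^ m).coeff (i - (N - m * 2)) else 0 := fun i =>
        coeff_mul_X_pow' _ _ _
      refine ⟨⟨z ^ m * X ^ (N - m * 2), fun i => ?_, fun i hi => ?_, ?_⟩, ?_⟩
      · rw [hco]
        split_ifs
        · rw [mem_skew, map_coeff_pow_of_skew h1 hmul hzS, hm, Odd.neg_one_pow ⟨_, rfl⟩,
            neg_one_mul]
        · exact zero_mem _
      · rw [hco, if_pos (by omega)]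
        refine coeff_eq_zero_of_natDegree_lt (lt_of_le_of_lt (natDegree_pow_le_of_le m hzdeg) ?_)
        omega
      · rw [mul_assoc, X_pow_mul, ← mul_assoc, ← mul_assoc, ← pow_succ, ← pow_succ']
      · rw [curveCoeff_apply, hco, if_pos (by omega), Nat.sub_sub_self hmN,
          coeff_pow_of_natDegree_le hzdeg, hz2]
    rw [← Fintype.card_fin n, ← finrank_span_eq_card hind]
    refine Submodule.finrank_mono (Submodule.span_le.2 ?_)
    rintro _ ⟨j, rfl⟩
    exact hmem j
  · rintro _ ⟨⟨p, hp1, -, hp3⟩, rfl⟩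
    refine ⟨hp1 0, ?_, p.coeff 1, hp1 1, ?_⟩
    · simpa [mul_coeff_zero, hz0] using congrArg (fun r => coeff r 0) hp3
    · have := congrArg (fun r => coeff r 1) hp3
      simp only [coeff_mul, Finset.Nat.antidiagonal_succ, Finset.Nat.antidiagonal_zero] at this
      simp [hz0, hz1] at this
      simp only [curveCoeff_apply]
      rw [this, add_comm]

end Curve

/-! ### The adjoint involution and covectors on centralisers -/

section Adjoint

variable {K V : Type*} [Field K] [AddCommGroup V] [Module K V]
  {ω : LinearMap.BilinForm K V}

theorem eq_of_forall_apply_left (hω : ω.Nondegenerate) {v w : V} (h : ∀ u, ω v u = ω w u) :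
    v = w := by
  rw [← sub_eq_zero]
  exact hω.1 _ fun u => by simp [h u]

theorem apply_pow_of_mem_sp {x : End K V} (hx : x ∈ sp ω) (s : ℕ) (v u : V) :
    ω ((x ^ s) v) u = (-1) ^ s * ω v ((x ^ s) u) := by
  induction s generalizing v u with
  | zero => simp
  | succ s ih =>
    rw [pow_succ x, Module.End.mul_apply, ih, mem_sp.1 hx, ← Module.End.mul_apply, ← pow_succ',
      ← pow_succ, pow_succ (-1 : K)]
    ring

theorem apply_pow_pow_of_mem_sp {x : End K V} (hx : x ∈ sp ω) (s t : ℕ) (v u : V) :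
    ω ((x ^ s) v) ((x ^ t) u) = (-1) ^ t * ω ((x ^ (t + s)) v) u := by
  rw [pow_add, Module.End.mul_apply, apply_pow_of_mem_sp hx t, ← mul_assoc, ← mul_pow]
  simp

theorem finrank_coadjointStabilizer_eq (e : sp ω) (β : Dual K (centralizer K e)) :
    finrank K (coadjointStabilizer β) =
      finrank K ((coadjointStabilizer β).map
        ((sp ω).incl.comp (centralizer K e).incl)) :=
  LinearEquiv.finrank_eq (Submodule.equivMapOfInjective
    ((sp ω).incl.comp (centralizer K e).incl : centralizer K e →ₗ[K] End K V)
    (Subtype.val_injective.comp Subtype.val_injective) (coadjointStabilizer β).toSubmodule)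

theorem mem_map_coadjointStabilizer {e : sp ω} {β : Dual K (centralizer K e)} {x : End K V} :
    x ∈ (coadjointStabilizer β).map ((sp ω).incl.comp (centralizer K e).incl) ↔
      ∃ (hx : x ∈ sp ω) (hc : (⟨x, hx⟩ : sp ω) ∈ centralizer K e),
        ∀ y, β ⁅(⟨⟨x, hx⟩, hc⟩ : centralizer K e), y⁆ = 0 := by
  constructor
  · rintro ⟨⟨⟨x, hx⟩, hc⟩, h, rfl⟩
    exact ⟨hx, hc, h⟩
  · rintro ⟨hx, hc, h⟩
    exact ⟨⟨⟨x, hx⟩, hc⟩, h, rfl⟩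

theorem lie_eq_zero_iff_mul {x y : End K V} : ⁅x, y⁆ = 0 ↔ x * y = y * x := by
  rw [LieRing.of_associative_ring_bracket, sub_eq_zero]

variable [FiniteDimensional K V]

/-- The adjoint involution of `End V` with respect to a non-degenerate bilinear form. -/
noncomputable def adj (hω : ω.Nondegenerate) : End K V →ₗ[K] End K V :=
  (ω.toDual hω).symm.conj.toLinearMap ∘ₗ Dual.transpose

theorem apply_adj_left (hω : ω.Nondegenerate) (x : End K V) (v u : V) :
    ω (adj hω x v) u = ω v (x u) := by
  have : ω.toDual hω (adj hω x v) = Dual.transpose x (ω.toDual hω v) := by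
    simp [adj, LinearEquiv.conj_apply]
  exact LinearMap.congr_fun this u

theorem adj_eq_iff (hω : ω.Nondegenerate) {x y : End K V} :
    adj hω x = y ↔ ∀ v u, ω (y v) u = ω v (x u) := by
  refine ⟨fun h v u => by rw [← h, apply_adj_left], fun h => ?_⟩
  ext v
  exact eq_of_forall_apply_left hω fun u => by rw [apply_adj_left, h]

theorem adj_one (hω : ω.Nondegenerate) : adj hω 1 = 1 :=
  (adj_eq_iff hω).2 fun _ _ => rfl

theorem adj_mul (hω : ω.Nondegenerate) (x y : End K V) :
    adj hω (x * y) = adj hω y * adj hω x :=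
  (adj_eq_iff hω).2 fun v u => by
    rw [Module.End.mul_apply, Module.End.mul_apply, apply_adj_left, apply_adj_left]

theorem adj_adj (hω : ω.Nondegenerate) (halt : ω.IsAlt) (x : End K V) :
    adj hω (adj hω x) = x :=
  (adj_eq_iff hω).2 fun v u => by
    rw [← halt.neg_eq, ← apply_adj_left hω x, halt.neg_eq]

theorem trace_adj (hω : ω.Nondegenerate) (x : End K V) :
    LinearMap.trace K V (adj hω x) = LinearMap.trace K V x := by
  simp [adj, LinearMap.trace_conj', LinearMap.trace_transpose']

theorem mem_sp_iff_adj (hω : ω.Nondegenerate) {x : End K V} : x ∈ sp ω ↔ adj hω x = -x := by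
  rw [mem_sp, adj_eq_iff]
  refine forall_congr' fun v => forall_congr' fun u => ?_
  simp [neg_eq_iff_eq_neg]

theorem mem_sp_iff_mem_skew (hω : ω.Nondegenerate) {x : End K V} :
    x ∈ sp ω ↔ x ∈ skew (adj hω) := by
  rw [mem_sp_iff_adj hω, mem_skew]

theorem sub_adj_mem_sp (hω : ω.Nondegenerate) (halt : ω.IsAlt) (x : End K V) :
    x - adj hω x ∈ sp ω := by
  rw [mem_sp_iff_adj hω, map_sub, adj_adj hω halt, neg_sub]

theorem add_adj_eq (hω : ω.Nondegenerate) (halt : ω.IsAlt) (x : End K V) :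
    adj hω (x + adj hω x) = x + adj hω x := by
  rw [map_add, adj_adj hω halt, add_comm]

/-- Every covector on `End V` is of the form `y ↦ tr (b y)`. -/
theorem exists_trace_mul_eq (f : Dual K (End K V)) :
    ∃ b : End K V, ∀ y, f y = LinearMap.trace K V (b * y) := by
  let T : End K V →ₗ[K] Dual K (End K V) :=
    (LinearMap.mul K (End K V)).compr₂ (LinearMap.trace K V)
  have hT : Function.Injective T := by
    rw [← LinearMap.ker_eq_bot, LinearMap.ker_eq_bot']
    intro b hb
    let B := finBasis K V
    apply (LinearMap.toMatrix B B).injective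
    rw [map_zero, Matrix.ext_iff_trace_mul_right]
    intro x
    have := LinearMap.congr_fun hb (Matrix.toLin B B x)
    rw [Matrix.zero_mul, Matrix.trace_zero]
    simpa [T, LinearMap.trace_eq_matrix_trace K B, LinearMap.toMatrix_mul] using this
  obtain ⟨b, hb⟩ := (LinearMap.injective_iff_surjective_of_finrank_eq_finrank
    (Subspace.dual_finrank_eq).symm).1 hT f
  exact ⟨b, fun y => by rw [← hb]; rfl⟩

/-- Every covector on the centraliser of `e` in `sp(V)` is of the form `y ↦ tr (b y)` with
`b` in `sp(V)`. -/
theorem exists_mem_sp_trace_mul_eq (h2 : (2 : K) ≠ 0) (hω : ω.Nondegenerate) (halt : ω.IsAlt)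
    (e : sp ω) (β : Dual K (centralizer K e)) :
    ∃ b ∈ sp ω, ∀ y : centralizer K e, β y = LinearMap.trace K V (b * ((y : sp ω) : End K V)) := by
  obtain ⟨g, hg⟩ := LinearMap.exists_extend (p := (centralizer K e).toSubmodule) β
  obtain ⟨f, hf⟩ := LinearMap.exists_extend (p := (sp ω).toSubmodule) g
  obtain ⟨b, hb⟩ := exists_trace_mul_eq f
  refine ⟨(2 : K)⁻¹ • (b - adj hω b), (sp ω).smul_mem _ (sub_adj_mem_sp hω halt b), fun y => ?_⟩
  have hβ : β y = LinearMap.trace K V (b * ((y : sp ω) : End K V)) := by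
    rw [← hb, ← hg]
    exact (LinearMap.congr_fun hf (y : sp ω)).symm
  have hadj : LinearMap.trace K V (adj hω b * ((y : sp ω) : End K V)) = - β y := by
    rw [hβ, ← trace_adj hω (b * _), adj_mul, (mem_sp_iff_adj hω).1 (y : sp ω).2, neg_mul, map_neg,
      neg_neg, LinearMap.trace_mul_comm]
  rw [smul_mul_assoc, map_smul, sub_mul, map_sub, hadj, ← hβ, smul_eq_mul]
  field_simp
  ring

/-- Stabilisers of covectors on the centraliser of any `e` in `sp(V)` have dimension at least `n`,
once `sp(V)` contains an element with `n` linearly independent odd powers: a first order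
deformation of `x` commuting with `e + t b` puts `x` into the stabiliser of `tr (b ·)`. -/
theorem le_finrank_coadjointStabilizer (h2 : (2 : K) ≠ 0) (hω : ω.Nondegenerate) (halt : ω.IsAlt)
    {n : ℕ} {h : End K V} (hh : h ∈ sp ω)
    (hind : LinearIndependent K fun j : Fin n => h ^ (2 * (j : ℕ) + 1))
    (e : sp ω) (β : Dual K (centralizer K e)) : n ≤ finrank K (coadjointStabilizer β) := by
  obtain ⟨b, hb, hβ⟩ := exists_mem_sp_trace_mul_eq h2 hω halt e β
  obtain ⟨W, hW, hWmem⟩ := exists_deformable_centralizer (adj_one hω) (adj_mul hω)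
    ((mem_sp_iff_mem_skew hω).1 hh) hind ((mem_sp_iff_mem_skew hω).1 e.2)
    ((mem_sp_iff_mem_skew hω).1 hb)
  rw [finrank_coadjointStabilizer_eq]
  refine hW.trans (Submodule.finrank_mono fun x hx => ?_)
  obtain ⟨hxS, hex, y, -, hxy⟩ := hWmem x hx
  refine mem_map_coadjointStabilizer.2 ⟨(mem_sp_iff_mem_skew hω).2 hxS,
    Subtype.ext (lie_eq_zero_iff_mul.2 hex), fun z => ?_⟩
  have hz : (e : End K V) * ((z : sp ω) : End K V) = ((z : sp ω) : End K V) * (e : End K V) :=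
    lie_eq_zero_iff_mul.1 (congrArg Subtype.val z.2)
  set c : End K V := ((z : sp ω) : End K V)
  have hbr : b * x - x * b = y * (e : End K V) - (e : End K V) * y := by
    rw [sub_eq_sub_iff_add_eq_add, add_comm, hxy]
  rw [hβ]
  change LinearMap.trace K V (b * (x * c - c * x)) = 0
  have e1 : LinearMap.trace K V (b * (x * c - c * x)) =
      LinearMap.trace K V ((b * x - x * b) * c) := by
    rw [mul_sub, sub_mul, map_sub, map_sub, ← mul_assoc, ← mul_assoc b,
      LinearMap.trace_mul_comm K (b * c) x, mul_assoc x]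
  rw [e1, hbr, sub_mul, map_sub, mul_assoc y, hz, mul_assoc (e : End K V),
    LinearMap.trace_mul_comm K (e : End K V), mul_assoc y, sub_self]

end Adjoint

/-! ### Symplectic bases and a regular nilpotent element -/

section SymplecticBasis

variable {K V : Type*} [Field K] [AddCommGroup V] [Module K V] [FiniteDimensional K V]
  {ω : LinearMap.BilinForm K V}

/-- Partial symplectic bases: `m` orthogonal hyperbolic pairs, for every `m` allowed by the
dimension. -/
theorem exists_hyperbolic_pairs (hω : ω.Nondegenerate) (halt : ω.IsAlt) (m : ℕ)
    (hm : 2 * m ≤ finrank K V) :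
    ∃ P Q : ℕ → V, (∀ i < m, ∀ j < m, ω (P i) (P j) = 0) ∧ (∀ i < m, ∀ j < m, ω (Q i) (Q j) = 0) ∧
      ∀ i < m, ∀ j < m, ω (P i) (Q j) = if i = j then 1 else 0 := by
  induction m with
  | zero => exact ⟨0, 0, by simp, by simp, by simp⟩
  | succ m ih =>
    obtain ⟨P, Q, hP, hQ, hPQ⟩ := ih (by omega)
    have hQP : ∀ i < m, ∀ j < m, ω (Q i) (P j) = if i = j then -1 else 0 := by
      intro i hi j hj
      rw [← halt.neg_eq, hPQ j hj i hi]
      rcases eq_or_ne i j with rfl | h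
      · simp
      · simp [h, h.symm]
    let f : V →ₗ[K] (Fin m ⊕ Fin m → K) :=
      LinearMap.pi fun s => ω.flip (Sum.elim (fun i : Fin m => P i) (fun i : Fin m => Q i) s)
    have hker : LinearMap.ker f ≠ ⊥ := by
      apply LinearMap.ker_ne_bot_of_finrank_lt
      rw [finrank_fintype_fun_eq_card, Fintype.card_sum, Fintype.card_fin]
      omega
    obtain ⟨x, hx, hx0⟩ := Submodule.exists_mem_ne_zero_of_ne_bot hker
    have hxP : ∀ i < m, ω x (P i) = 0 := fun i hi => congrFun hx (Sum.inl ⟨i, hi⟩)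
    have hxQ : ∀ i < m, ω x (Q i) = 0 := fun i hi => congrFun hx (Sum.inr ⟨i, hi⟩)
    obtain ⟨y, hy⟩ : ∃ y, ω x y ≠ 0 := by
      by_contra! h
      exact hx0 (hω.1 x h)
    -- the component of `y` orthogonal to the pairs found so far
    set z := y - ∑ i ∈ Finset.range m, ω y (Q i) • P i + ∑ i ∈ Finset.range m, ω y (P i) • Q i
      with hz
    have hxz : ω x z = ω x y := by
      rw [hz, map_add, map_sub, map_sum, map_sum, Finset.sum_eq_zero, Finset.sum_eq_zero, sub_zero,
        add_zero]
      · intro i hi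
        simp [hxQ i (Finset.mem_range.1 hi)]
      · intro i hi
        simp [hxP i (Finset.mem_range.1 hi)]
    have hzP : ∀ j < m, ω z (P j) = 0 := by
      intro j hj
      have e1 : ∑ i ∈ Finset.range m, ω y (Q i) * ω (P i) (P j) = 0 :=
        Finset.sum_eq_zero fun i hi => by rw [hP i (Finset.mem_range.1 hi) j hj, mul_zero]
      have e2 : ∑ i ∈ Finset.range m, ω y (P i) * ω (Q i) (P j) = - ω y (P j) := by
        rw [Finset.sum_eq_single_of_mem j (Finset.mem_range.2 hj), hQP j hj j hj]
        · simp
        · intro i hi hij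
          rw [hQP i (Finset.mem_range.1 hi) j hj, if_neg hij, mul_zero]
      simp [hz, LinearMap.sum_apply, e1, e2]
    have hzQ : ∀ j < m, ω z (Q j) = 0 := by
      intro j hj
      have e1 : ∑ i ∈ Finset.range m, ω y (P i) * ω (Q i) (Q j) = 0 :=
        Finset.sum_eq_zero fun i hi => by rw [hQ i (Finset.mem_range.1 hi) j hj, mul_zero]
      have e2 : ∑ i ∈ Finset.range m, ω y (Q i) * ω (P i) (Q j) = ω y (Q j) := by
        rw [Finset.sum_eq_single_of_mem j (Finset.mem_range.2 hj), hPQ j hj j hj]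
        · simp
        · intro i hi hij
          rw [hPQ i (Finset.mem_range.1 hi) j hj, if_neg hij, mul_zero]
      simp [hz, LinearMap.sum_apply, e1, e2]
    have hPx : ∀ i < m, ω (P i) x = 0 := fun i hi => by rw [← halt.neg_eq, hxP i hi, neg_zero]
    have hQz : ∀ i < m, ω (Q i) z = 0 := fun i hi => by rw [← halt.neg_eq, hzQ i hi, neg_zero]
    have hPz : ∀ i < m, ω (P i) z = 0 := fun i hi => by rw [← halt.neg_eq, hzP i hi, neg_zero]
    refine ⟨Function.update P m x, Function.update Q m ((ω x y)⁻¹ • z), ?_, ?_, ?_⟩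
    all_goals
      intro i hi j hj
      rcases Nat.lt_succ_iff_lt_or_eq.1 hi with hi | rfl <;>
      rcases Nat.lt_succ_iff_lt_or_eq.1 hj with hj | rfl
    · simp [hi.ne, hj.ne, hP i hi j hj]
    · simp [hi.ne, hPx i hi]
    · simp [hj.ne, hxP j hj]
    · simp [halt.self_eq_zero]
    · simp [hi.ne, hj.ne, hQ i hi j hj]
    · simp [hi.ne, hQz i hi]
    · simp [hj.ne, hzQ j hj]
    · simp [halt.self_eq_zero]
    · simp [hi.ne, hj.ne, hPQ i hi j hj]
    · simp [hi.ne, hPz i hi]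
    · simp [hj.ne, hxQ j hj, hj.ne']
    · simp [hxz, hy]

/-- A symplectic basis, ordered and signed in such a way that the shift of the basis is
skew-adjoint. -/
theorem exists_symplectic_basis (hω : ω.Nondegenerate) (halt : ω.IsAlt) {n : ℕ}
    (hV : finrank K V = 2 * n) :
    ∃ u : Basis (Fin (2 * n)) K V,
      ∀ i j, ω (u i) (u j) = if j = Fin.rev i then (-1) ^ (i : ℕ) else 0 := by
  obtain ⟨P, Q, hP, hQ, hPQ⟩ := exists_hyperbolic_pairs hω halt n hV.ge
  have hQP : ∀ i < n, ∀ j < n, ω (Q i) (P j) = if i = j then -1 else 0 := by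
    intro i hi j hj
    rw [← halt.neg_eq, hPQ j hj i hi]
    rcases eq_or_ne i j with rfl | h
    · simp
    · simp [h, h.symm]
  let v : Fin (2 * n) → V := fun i =>
    if (i : ℕ) < n then P i else (-1 : K) ^ (Fin.rev i : ℕ) • Q (Fin.rev i)
  have hv : ∀ i j, ω (v i) (v j) = if j = Fin.rev i then (-1) ^ (i : ℕ) else 0 := by
    intro i j
    have hi' := Fin.val_rev i
    have hj' := Fin.val_rev j
    have hjr : j = Fin.rev i ↔ (j : ℕ) = Fin.rev i := Fin.ext_iff
    by_cases hi : (i : ℕ) < n <;> by_cases hj : (j : ℕ) < n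
    · simp only [v, hi, hj, if_true]
      rw [hP _ hi _ hj, if_neg (by omega)]
    · simp only [v, hi, hj, if_true, if_false]
      rw [map_smul, hPQ _ hi _ (by omega), smul_eq_mul]
      by_cases h : j = Fin.rev i
      · rw [if_pos h, h, Fin.rev_rev, if_pos rfl, mul_one]
      · rw [if_neg h, if_neg (by omega), mul_zero]
    · simp only [v, hi, hj, if_true, if_false]
      rw [map_smul, LinearMap.smul_apply, hQP _ (by omega) _ hj, smul_eq_mul]
      by_cases h : j = Fin.rev i
      · rw [if_pos h, h, if_pos rfl, mul_neg_one, ← mul_neg_one, ← pow_succ]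
        apply neg_one_pow_congr
        rw [Nat.even_iff, Nat.even_iff]
        omega
      · rw [if_neg h, if_neg (by omega), mul_zero]
    · simp only [v, hi, hj, if_false]
      rw [map_smul, map_smul, LinearMap.smul_apply, hQ _ (by omega) _ (by omega),
        if_neg (by omega), smul_zero, smul_zero]
  have hli : LinearIndependent K v := by
    rw [Fintype.linearIndependent_iff]
    intro c hc i
    have : ω (∑ j, c j • v j) (v (Fin.rev i)) = 0 := by rw [hc, map_zero, LinearMap.zero_apply]
    rw [map_sum, LinearMap.sum_apply, Finset.sum_eq_single i, map_smul, LinearMap.smul_apply, hv,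
      if_pos rfl, smul_eq_mul, mul_eq_zero] at this
    · exact this.resolve_right (pow_ne_zero _ (neg_ne_zero.2 one_ne_zero))
    · intro j _ hj
      rw [map_smul, LinearMap.smul_apply, hv, if_neg (fun h => hj (Fin.rev_injective h).symm),
        smul_zero]
    · simp
  refine ⟨basisOfLinearIndependentOfCardEqFinrank' v hli (by simp [hV]), fun i j => ?_⟩
  simp only [coe_basisOfLinearIndependentOfCardEqFinrank']
  exact hv i j

/-- The regular nilpotent element: an element of `sp(V)` with `n` linearly independent odd
powers. -/
theorem exists_linearIndependent_odd_pow (hω : ω.Nondegenerate) (halt : ω.IsAlt) {n : ℕ}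
    (hV : finrank K V = 2 * n) :
    ∃ h ∈ sp ω, LinearIndependent K fun j : Fin n => h ^ (2 * (j : ℕ) + 1) := by
  obtain ⟨u, hu⟩ := exists_symplectic_basis hω halt hV
  let h : End K V := u.constr K fun i =>
    if hi : (i : ℕ) + 1 < 2 * n then u ⟨i + 1, hi⟩ else 0
  have hhu : ∀ i, h (u i) = if hi : (i : ℕ) + 1 < 2 * n then u ⟨i + 1, hi⟩ else 0 := fun i =>
    u.constr_basis K _ i
  refine ⟨h, ?_, ?_⟩
  · have : ω.compLeft h = -(ω.compRight h) := by
      refine LinearMap.BilinForm.ext_basis u fun i j => ?_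
      rw [LinearMap.neg_apply, LinearMap.neg_apply]
      change ω (h (u i)) (u j) = - ω (u i) (h (u j))
      rw [hhu, hhu]
      have hi' := Fin.val_rev i
      split_ifs with hi hj hj
      · rw [hu, hu]
        have := Fin.val_rev ⟨(i : ℕ) + 1, hi⟩
        simp only [Fin.ext_iff]
        by_cases hij : (i : ℕ) + 1 + j + 1 = 2 * n
        · rw [if_pos (by simp_all; omega), if_pos (by simp_all; omega)]
          ring
        · rw [if_neg (by simp_all; omega), if_neg (by simp_all; omega), neg_zero]
      · rw [hu, if_neg (by rw [Fin.ext_iff, Fin.val_rev]; simp only; omega), map_zero, neg_zero]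
      · rw [hu, if_neg (by rw [Fin.ext_iff, Fin.val_rev]; simp only; omega), map_zero,
          LinearMap.zero_apply,
          neg_zero]
      · simp
    rw [mem_sp]
    intro v w
    exact LinearMap.congr_fun (LinearMap.congr_fun this v) w
  · rcases Nat.eq_zero_or_pos n with rfl | hn
    · exact linearIndependent_empty_type
    have hpow : ∀ j (hj : j < 2 * n), (h ^ j) (u ⟨0, by omega⟩) = u ⟨j, hj⟩ := by
      intro j
      induction j with
      | zero => simp
      | succ j ih =>
        intro hj
        rw [pow_succ', Module.End.mul_apply, ih (by omega), hhu, dif_pos hj]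
    refine LinearIndependent.of_comp (LinearMap.applyₗ (u ⟨0, by omega⟩)) ?_
    have : (LinearMap.applyₗ (u ⟨0, by omega⟩) : End K V →ₗ[K] V) ∘
        (fun j : Fin n => h ^ (2 * (j : ℕ) + 1)) =
        u ∘ fun j : Fin n => ⟨2 * (j : ℕ) + 1, by omega⟩ := by
      ext j
      exact hpow (2 * (j : ℕ) + 1) (by omega)
    rw [this]
    refine u.linearIndependent.comp _ fun i j hij => ?_
    rw [Fin.ext_iff] at hij ⊢
    simp at hij
    exact hij

end SymplecticBasis

/-! ### Existence of adapted generators of the Jordan blocks -/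

section Existence

variable {K V : Type*} [Field K] [AddCommGroup V] [Module K V]
  {ω : LinearMap.BilinForm K V} {e : End K V}

/-- A family of vectors that satisfies the conditions on adapted generators, except that it need
not generate `V`. Instead, the last vector of each block pairs non-trivially with the first vector
of the partner block. -/
structure IsAdapted (ω : LinearMap.BilinForm K V) (e : End K V) {ι : Type*} (d : ι → ℕ) (w : ι → V)
    (pair : ι → ι) : Prop where
  pair_pair : ∀ i, pair (pair i) = i
  pair_eq_self_iff : ∀ i, pair i = i ↔ Even (d i + 1)
  d_pair : ∀ i, d (pair i) = d i
  orthogonal : ∀ i j, j ≠ pair i → ∀ s t : ℕ, ω ((e ^ s) (w i)) ((e ^ t) (w j)) = 0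
  pow_apply_eq_zero : ∀ i, (e ^ (d i + 1)) (w i) = 0
  apply_ne_zero : ∀ i, ω ((e ^ d i) (w i)) (w (pair i)) ≠ 0

theorem pow_apply_eq_zero_of_le {s t : ℕ} {v : V} (h : (e ^ s) v = 0) (hst : s ≤ t) :
    (e ^ t) v = 0 := by
  obtain ⟨r, rfl⟩ := Nat.exists_eq_add_of_le' hst
  rw [pow_add, Module.End.mul_apply, h, map_zero]

namespace IsAdapted

variable {ι : Type*} {d : ι → ℕ} {w : ι → V} {pair : ι → ι}

/-- The Gram matrix of an adapted family is triangular with non-zero diagonal, once the vectors of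
the partner block are listed in reverse order. -/
theorem coeff_eq_zero [Fintype ι] (h : IsAdapted ω e d w pair) (he : e ∈ sp ω)
    (c : (Σ i, Fin (d i + 1)) → K)
    (hc : ∀ j t, ω (∑ p, c p • (e ^ (p.2 : ℕ)) (w p.1)) ((e ^ t) (w j)) = 0) : c = 0 := by
  have key : ∀ s i (hs : s < d i + 1), c ⟨i, ⟨s, hs⟩⟩ = 0 := by
    intro s
    induction s using Nat.strong_induction_on with
    | _ s ih =>
      intro i hs
      have h1 := hc (pair i) (d i - s)
      rw [map_sum, LinearMap.sum_apply, Finset.sum_eq_single ⟨i, ⟨s, hs⟩⟩] at h1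
      · rw [map_smul, LinearMap.smul_apply, apply_pow_pow_of_mem_sp he, smul_eq_mul,
          Nat.sub_add_cancel (Nat.lt_succ_iff.1 hs), mul_eq_zero] at h1
        exact h1.resolve_right (mul_ne_zero (pow_ne_zero _ (neg_ne_zero.2 one_ne_zero))
          (h.apply_ne_zero i))
      · rintro ⟨j, t⟩ - hp
        rw [map_smul, LinearMap.smul_apply]
        dsimp only
        by_cases hj : j = i
        · subst hj
          rcases lt_trichotomy (t : ℕ) s with hts | hts | hts
          · rw [ih t hts j t.2, zero_smul]
          · exact absurd (by subst hts; rfl) hp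
          · rw [apply_pow_pow_of_mem_sp he,
              pow_apply_eq_zero_of_le (h.pow_apply_eq_zero j) (by omega)]
            simp
        · rw [h.orthogonal j (pair i) fun hij => hj ?_, smul_zero]
          rw [← h.pair_pair j, ← hij, h.pair_pair]
      · simp
  funext p
  exact key p.2 p.1 p.2.2

theorem linearIndependent [Fintype ι] (h : IsAdapted ω e d w pair) (he : e ∈ sp ω) :
    LinearIndependent K fun p : Σ i, Fin (d i + 1) => (e ^ (p.2 : ℕ)) (w p.1) := by
  rw [Fintype.linearIndependent_iff]
  intro c hc p
  rw [h.coeff_eq_zero he c fun j t => by rw [hc, map_zero, LinearMap.zero_apply]]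
  rfl

/-- The union of two mutually orthogonal adapted families is adapted. -/
theorem sum (halt : ω.IsAlt) (h : IsAdapted ω e d w pair)
    {ι' : Type*} {d' : ι' → ℕ} {w' : ι' → V}
    {pair' : ι' → ι'} (h' : IsAdapted ω e d' w' pair')
    (horth : ∀ i j, ∀ s t : ℕ, ω ((e ^ s) (w i)) ((e ^ t) (w' j)) = 0) :
    IsAdapted ω e (Sum.elim d d') (Sum.elim w w') (Sum.map pair pair') where
  pair_pair i := by rcases i with i | i <;> simp [h.pair_pair, h'.pair_pair]
  pair_eq_self_iff i := by
    rcases i with i | i <;> simp [h.pair_eq_self_iff, h'.pair_eq_self_iff]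
  d_pair i := by rcases i with i | i <;> simp [h.d_pair, h'.d_pair]
  orthogonal i j hij s t := by
    rcases i with i | i <;> rcases j with j | j
    · exact h.orthogonal i j (by simpa using hij) s t
    · exact horth i j s t
    · rw [← halt.neg_eq]
      simpa using horth j i t s
    · exact h'.orthogonal i j (by simpa using hij) s t
  pow_apply_eq_zero i := by
    rcases i with i | i <;> simp [h.pow_apply_eq_zero, h'.pow_apply_eq_zero]
  apply_ne_zero i := by
    rcases i with i | i
    · exact h.apply_ne_zero i
    · exact h'.apply_ne_zero i

theorem reindex (h : IsAdapted ω e d w pair) {ι' : Type*} (f : ι' ≃ ι) :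
    IsAdapted ω e (d ∘ f) (w ∘ f) (f.symm ∘ pair ∘ f) where
  pair_pair i := by simp [h.pair_pair]
  pair_eq_self_iff i := by simp [h.pair_eq_self_iff, Equiv.symm_apply_eq]
  d_pair i := by simp [h.d_pair]
  orthogonal i j hij s t := h.orthogonal (f i) (f j)
    (fun hc => hij (by simp [← hc])) s t
  pow_apply_eq_zero i := h.pow_apply_eq_zero (f i)
  apply_ne_zero i := by simpa using h.apply_ne_zero (f i)

end IsAdapted

theorem apply_pow_even_self (halt : ω.IsAlt) (he : e ∈ sp ω) {s : ℕ} (hs : Even s) (v : V) :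
    ω ((e ^ s) v) v = 0 := by
  obtain ⟨r, rfl⟩ := hs
  rw [pow_add, Module.End.mul_apply, apply_pow_of_mem_sp he, halt.self_eq_zero, mul_zero]

/-- For odd `d`, the form `ω (e ^ d v) w` is symmetric, so it does not vanish on the diagonal
unless it is zero. -/
theorem exists_apply_pow_odd_self_ne_zero (h2 : (2 : K) ≠ 0) (halt : ω.IsAlt) (he : e ∈ sp ω)
    {U : Submodule K V} {d : ℕ} (hd : Odd d) {v w : V} (hv : v ∈ U) (hw : w ∈ U)
    (hvw : ω ((e ^ d) v) w ≠ 0) : ∃ x ∈ U, ω ((e ^ d) x) x ≠ 0 := by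
  by_contra! h
  have hwv : ω ((e ^ d) w) v = ω ((e ^ d) v) w := by
    rw [apply_pow_of_mem_sp he, hd.neg_one_pow, ← halt.neg_eq]
    simp
  have h1 := h (v + w) (add_mem hv hw)
  simp only [map_add, LinearMap.add_apply] at h1
  rw [h v hv, h w hw, hwv, zero_add, add_zero, ← two_mul] at h1
  exact mul_ne_zero h2 hvw h1

/-- For even `d`, the generator `v` of a block can be made isotropic by adding multiples of the
vectors `e ^ r w`, `r ≥ 1`, of the partner block, killing `ω (e ^ s v) v` for one `s` after the
other, from the largest downwards. -/
theorem exists_isotropic (h2 : (2 : K) ≠ 0) (halt : ω.IsAlt) (he : e ∈ sp ω)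
    {U : Submodule K V} (heU : ∀ x ∈ U, e x ∈ U) {d : ℕ} (hd : Even d)
    (hU : ∀ x ∈ U, (e ^ (d + 1)) x = 0) {v w : V}
    (hv : v ∈ U) (hw : w ∈ U) (hvw : ω ((e ^ d) v) w ≠ 0) :
    ∃ x ∈ U, ω ((e ^ d) x) w ≠ 0 ∧ ∀ s, ω ((e ^ s) x) x = 0 := by
  have hpowU : ∀ s, ∀ x ∈ U, (e ^ s) x ∈ U := by
    intro s x hx
    induction s with
    | zero => simpa
    | succ s ih =>
      rw [pow_succ', Module.End.mul_apply]
      exact heU _ ih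
  have hlarge : ∀ s, d < s → ∀ x ∈ U, (e ^ s) x = 0 := fun s hs x hx =>
    pow_apply_eq_zero_of_le (hU x hx) hs
  have key : ∀ m, ∃ x ∈ U, ω ((e ^ d) x) w ≠ 0 ∧ ∀ s, d < s + m → ω ((e ^ s) x) x = 0 := by
    intro m
    induction m with
    | zero => exact ⟨v, hv, hvw, fun s hs => by rw [hlarge s hs v hv]; simp⟩
    | succ m ih =>
      obtain ⟨x, hx, hxw, hxs⟩ := ih
      by_cases hm : d < m ∨ Even (d - m)
      · refine ⟨x, hx, hxw, fun s hs => ?_⟩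
        by_cases hs' : d < s + m
        · exact hxs s hs'
        · rcases hm with hm | hm
          · omega
          · have : s = d - m := by omega
            rw [this]
            exact apply_pow_even_self halt he hm x
      · push Not at hm
        obtain ⟨hm1, hm2⟩ := hm
        have hm0 : m ≠ 0 := by
          rintro rfl
          exact hm2 hd
        have hodd : Odd (d - m) := Nat.not_even_iff_odd.1 hm2
        have hmodd : Odd m := by
          by_contra hc
          exact hm2 ((Nat.even_sub hm1).2 (by simp [hd, Nat.not_odd_iff_even.1 hc]))
        set c : K := ω ((e ^ (d - m)) x) x / (2 * ω ((e ^ d) x) w) with hc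
        have hmw : (e ^ m) w ∈ U := hpowU m w hw
        refine ⟨x + c • (e ^ m) w, add_mem hx (U.smul_mem c hmw), ?_, fun s hs => ?_⟩
        · rw [map_add, map_smul, ← Module.End.mul_apply, ← pow_add,
            hlarge (d + m) (by omega) w hw, smul_zero, add_zero]
          exact hxw
        · have e1 : ω ((e ^ s) ((e ^ m) w)) ((e ^ m) w) = 0 := by
            rw [← Module.End.mul_apply, ← pow_add, apply_pow_pow_of_mem_sp he,
              hlarge (m + (s + m)) (by omega) w hw]
            simp
          have e2 : ω ((e ^ s) ((e ^ m) w)) x = ω ((e ^ (s + m)) w) x := by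
            rw [← Module.End.mul_apply, ← pow_add]
          have e3 : ω ((e ^ s) x) ((e ^ m) w) = - ω ((e ^ (s + m)) x) w := by
            rw [apply_pow_pow_of_mem_sp he, hmodd.neg_one_pow, add_comm s m, neg_one_mul]
          simp only [map_add, map_smul, LinearMap.add_apply, LinearMap.smul_apply, smul_eq_mul]
          rw [e1, e2, e3]
          rcases (show d < s + m ∨ s + m = d by omega) with hsm | hsm
          · rw [hxs s hsm, hlarge _ hsm x hx, hlarge _ hsm w hw]
            simp
          · have hs' : s = d - m := by omega
            have e4 : ω ((e ^ d) w) x = - ω ((e ^ d) x) w := by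
              rw [apply_pow_of_mem_sp he, hd.neg_one_pow, one_mul, halt.neg_eq]
            rw [hsm, e4, hc, ← hs']
            field_simp
            ring
  obtain ⟨x, hx, hxw, hxs⟩ := key (d + 1)
  exact ⟨x, hx, hxw, fun s => hxs s (by omega)⟩

/-- An `e`-stable non-zero subspace on which the form is non-degenerate contains an adapted family:
a single even-dimensional block or a pair of odd-dimensional blocks, of maximal dimension. -/
theorem exists_isAdapted_of_ne_bot (h2 : (2 : K) ≠ 0) (halt : ω.IsAlt) (he : e ∈ sp ω)
    (hnil : IsNilpotent e) {U : Submodule K V} (heU : ∀ x ∈ U, e x ∈ U) (hU : U ≠ ⊥)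
    (hnd : ∀ x ∈ U, x ≠ 0 → ∃ y ∈ U, ω x y ≠ 0) :
    ∃ (ι : Type) (_ : Fintype ι) (_ : Nonempty ι) (d : ι → ℕ) (w : ι → V) (pair : ι → ι),
      IsAdapted ω e d w pair ∧ ∀ i, w i ∈ U := by
  classical
  have hpowU : ∀ s, ∀ x ∈ U, (e ^ s) x ∈ U := by
    intro s x hx
    induction s with
    | zero => simpa
    | succ s ih =>
      rw [pow_succ', Module.End.mul_apply]
      exact heU _ ih
  have hex : ∃ N, ∀ x ∈ U, (e ^ N) x = 0 := by
    obtain ⟨N, hN⟩ := hnil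
    exact ⟨N, fun x _ => by rw [hN, LinearMap.zero_apply]⟩
  obtain ⟨d, hd⟩ : ∃ d, Nat.find hex = d + 1 := by
    refine Nat.exists_eq_succ_of_ne_zero fun h0 => ?_
    obtain ⟨x, hx, hx0⟩ := Submodule.exists_mem_ne_zero_of_ne_bot hU
    have := Nat.find_spec hex x hx
    rw [h0] at this
    exact hx0 (by simpa using this)
  have hd0 : ∀ x ∈ U, (e ^ (d + 1)) x = 0 := hd ▸ Nat.find_spec hex
  obtain ⟨v, hv, hdv⟩ : ∃ v ∈ U, (e ^ d) v ≠ 0 := by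
    have := Nat.find_min hex (m := d) (by omega)
    push Not at this
    exact this
  obtain ⟨w, hw, hvw⟩ := hnd _ (hpowU d v hv) hdv
  rcases Nat.even_or_odd d with hpar | hpar
  · obtain ⟨x, hx, hxw, hxs⟩ := exists_isotropic h2 halt he heU hpar hd0 hv hw hvw
    have hwx : ω ((e ^ d) w) x ≠ 0 := by
      rw [apply_pow_of_mem_sp he, hpar.neg_one_pow, one_mul, ← halt.neg_eq]
      exact neg_ne_zero.2 hxw
    obtain ⟨y, hy, hyx, hys⟩ := exists_isotropic h2 halt he heU hpar hd0 hw hx hwx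
    have hxy : ω ((e ^ d) x) y ≠ 0 := by
      rw [apply_pow_of_mem_sp he, hpar.neg_one_pow, one_mul, ← halt.neg_eq]
      exact neg_ne_zero.2 hyx
    refine ⟨Bool, inferInstance, inferInstance, fun _ => d, fun i => bif i then x else y, not,
      ⟨by simp, ?_, by simp, ?_, ?_, ?_⟩, ?_⟩
    · intro i
      have : ¬ Even (d + 1) := Nat.not_even_iff_odd.2 hpar.add_one
      cases i <;> simp [this]
    · intro i j hij s t
      rw [apply_pow_pow_of_mem_sp he]
      cases i <;> cases j <;> simp at hij ⊢
      · exact hys _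
      · exact hxs _
    · intro i
      cases i
      · exact hd0 y hy
      · exact hd0 x hx
    · intro i
      cases i
      · exact hyx
      · exact hxy
    · intro i
      cases i
      · exact hy
      · exact hx
  · obtain ⟨x, hx, hxx⟩ := exists_apply_pow_odd_self_ne_zero h2 halt he hpar hv hw hvw
    exact ⟨Unit, inferInstance, inferInstance, fun _ => d, fun _ => x, id,
      ⟨fun _ => rfl, fun _ => by simpa using hpar.add_one, fun _ => rfl,
        fun _ _ h => absurd rfl h, fun _ => hd0 x hx, fun _ => hxx⟩, fun _ => hx⟩

variable [FiniteDimensional K V]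

/-- An adapted family that does not generate `V` extends to a larger one, by an adapted family in
the orthogonal complement of its span. -/
theorem IsAdapted.exists_extension (h2 : (2 : K) ≠ 0) (hω : ω.Nondegenerate) (halt : ω.IsAlt)
    (he : e ∈ sp ω) (hnil : IsNilpotent e) {ι : Type} [Fintype ι] {d : ι → ℕ} {w : ι → V}
    {pair : ι → ι} (h : IsAdapted ω e d w pair) (hlt : ∑ i, (d i + 1) < finrank K V) :
    ∃ (ι' : Type) (_ : Fintype ι') (d' : ι' → ℕ) (w' : ι' → V) (pair' : ι' → ι'),
      IsAdapted ω e d' w' pair' ∧ ∑ i, (d i + 1) < ∑ i, (d' i + 1) := by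
  set S : Submodule K V :=
    Submodule.span K (Set.range fun p : Σ i, Fin (d i + 1) => (e ^ (p.2 : ℕ)) (w p.1)) with hS
  have hmemS : ∀ i s, (e ^ s) (w i) ∈ S := by
    intro i s
    by_cases hs : s < d i + 1
    · exact Submodule.subset_span ⟨⟨i, ⟨s, hs⟩⟩, rfl⟩
    · rw [pow_apply_eq_zero_of_le (h.pow_apply_eq_zero i) (not_lt.1 hs)]
      exact zero_mem _
  have hmemU : ∀ x, x ∈ ω.orthogonal S ↔ ∀ i s, ω ((e ^ s) (w i)) x = 0 := by
    intro x
    rw [LinearMap.BilinForm.mem_orthogonal_iff]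
    refine ⟨fun hx i s => hx _ (hmemS i s), fun hx y hy => ?_⟩
    change ω y x = 0
    induction hy using Submodule.span_induction with
    | mem y hy => obtain ⟨p, rfl⟩ := hy; exact hx _ _
    | zero => simp
    | add y z _ _ hy hz => simp [hy, hz]
    | smul c y _ hy => simp [hy]
  have hcompl : IsCompl S (ω.orthogonal S) := by
    rw [LinearMap.BilinForm.isCompl_orthogonal_iff_disjoint halt.isRefl, Submodule.disjoint_def]
    intro x hx hx'
    obtain ⟨c, rfl⟩ := (Submodule.mem_span_range_iff_exists_fun K).1 hx
    rw [h.coeff_eq_zero he c fun j t => by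
      rw [← halt.neg_eq, (hmemU _).1 hx' j t, neg_zero]]
    simp
  have hne : ω.orthogonal S ≠ ⊥ := by
    intro hbot
    have : S = ⊤ := by simpa [hbot] using hcompl.sup_eq_top
    have hcard := finrank_span_eq_card (h.linearIndependent he)
    rw [← hS, this, finrank_top, Fintype.card_sigma] at hcard
    simp only [Fintype.card_fin] at hcard
    omega
  have heU : ∀ x ∈ ω.orthogonal S, e x ∈ ω.orthogonal S := by
    intro x hx
    rw [hmemU] at hx ⊢
    intro i s
    have := hx i (s + 1)
    rw [pow_succ', Module.End.mul_apply, mem_sp.1 he, neg_eq_zero] at this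
    exact this
  have hnd : ∀ x ∈ ω.orthogonal S, x ≠ 0 → ∃ y ∈ ω.orthogonal S, ω x y ≠ 0 := by
    intro x hx hx0
    obtain ⟨y, hy⟩ : ∃ y, ω x y ≠ 0 := by
      by_contra! hc
      exact hx0 (hω.1 x hc)
    obtain ⟨a, ha, b, hb, rfl⟩ := Submodule.mem_sup.1
      (hcompl.sup_eq_top.symm ▸ Submodule.mem_top : y ∈ S ⊔ ω.orthogonal S)
    refine ⟨b, hb, ?_⟩
    have : ω x a = 0 := by
      rw [← halt.neg_eq, (LinearMap.BilinForm.mem_orthogonal_iff.1 hx a ha : ω a x = 0), neg_zero]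
    rwa [map_add, this, zero_add] at hy
  obtain ⟨ι', _, _, d', w', pair', h', hw'⟩ := exists_isAdapted_of_ne_bot h2 halt he hnil
    heU hne hnd
  refine ⟨ι ⊕ ι', inferInstance, _, _, _, h.sum halt h' fun i j s t => ?_, ?_⟩
  · have := (hmemU _).1 (hw' j) i (t + s)
    rw [← mul_zero ((-1 : K) ^ t), ← this, apply_pow_pow_of_mem_sp he]
  · simp only [Fintype.sum_sum_type, Sum.elim_inl, Sum.elim_inr]
    refine Nat.lt_add_of_pos_right (Finset.sum_pos (fun _ _ => Nat.succ_pos _) ?_)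
    exact Finset.univ_nonempty

theorem exists_symplecticJordanGenerators (h2 : (2 : K) ≠ 0) (hω : ω.Nondegenerate)
    (halt : ω.IsAlt) (he : e ∈ sp ω) (hnil : IsNilpotent e) :
    ∃ k : ℕ, Nonempty (SymplecticJordanGenerators ω e k) := by
  have key : ∀ m ≤ finrank K V, ∃ (ι : Type) (_ : Fintype ι) (d : ι → ℕ) (w : ι → V)
      (pair : ι → ι), IsAdapted ω e d w pair ∧ m ≤ ∑ i, (d i + 1) := by
    intro m
    induction m with
    | zero =>
      intro _
      exact ⟨Empty, inferInstance, Empty.elim, Empty.elim, id,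
        ⟨nofun, nofun, nofun, nofun, nofun, nofun⟩, Nat.zero_le _⟩
    | succ m ih =>
      intro hm
      obtain ⟨ι, _, d, w, pair, h, hle⟩ := ih (by omega)
      by_cases hlt : ∑ i, (d i + 1) < finrank K V
      · obtain ⟨ι', _, d', w', pair', h', hlt'⟩ := h.exists_extension h2 hω halt he hnil hlt
        exact ⟨ι', _, d', w', pair', h', by omega⟩
      · exact ⟨ι, _, d, w, pair, h, by omega⟩
  obtain ⟨ι, _, d, w, pair, h, hle⟩ := key _ le_rfl
  let f := (Fintype.equivFin ι).symm
  have h' := h.reindex f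
  have hsum : ∑ i, ((d ∘ f) i + 1) = ∑ i, (d i + 1) := f.sum_comp fun i => d i + 1
  have hli := h'.linearIndependent he
  have hcard : Fintype.card (Σ i, Fin ((d ∘ f) i + 1)) = finrank K V := by
    refine le_antisymm hli.fintype_card_le_finrank ?_
    rw [Fintype.card_sigma]
    simp only [Fintype.card_fin]
    omega
  exact ⟨Fintype.card ι, ⟨{
    d := d ∘ f
    w := w ∘ f
    pair := f.symm ∘ pair ∘ f
    basis := basisOfLinearIndependentOfCardEqFinrank' _ hli hcard
    basis_apply := fun i s => by simp
    pow_apply_eq_zero := h'.pow_apply_eq_zero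
    pair_pair := h'.pair_pair
    pair_eq_self_iff := h'.pair_eq_self_iff
    d_pair := h'.d_pair
    orthogonal := h'.orthogonal }⟩⟩

end Existence

/-! ### Stabilisers of the covectors `α` -/

section Stabilizer

variable {K V : Type*} [Field K] [AddCommGroup V] [Module K V]

namespace JordanGenerators

variable {e : End K V} {k : ℕ} (J : JordanGenerators e k)

/-- The coordinate of a vector at `e ^ s (w j)`, which is zero by convention if `s > d j`. -/
noncomputable def coordAt (j : Fin k) (s : ℕ) : V →ₗ[K] K :=
  if h : s < J.d j + 1 then J.basis.coord ⟨j, ⟨s, h⟩⟩ else 0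

theorem coordAt_eq_repr {j : Fin k} {s : ℕ} (h : s < J.d j + 1) (x : V) :
    J.coordAt j s x = J.basis.repr x ⟨j, ⟨s, h⟩⟩ := by
  rw [coordAt, dif_pos h, Basis.coord_apply]

theorem coordAt_of_lt {j : Fin k} {s : ℕ} (h : J.d j < s) : J.coordAt j s = 0 :=
  dif_neg (by omega)

theorem ext_coordAt {x y : V} (h : ∀ j, ∀ s ≤ J.d j, J.coordAt j s x = J.coordAt j s y) :
    x = y := by
  refine J.basis.ext_elem fun p => ?_
  simpa [coordAt_eq_repr J p.2.2] using h p.1 p.2 (Nat.lt_succ_iff.1 p.2.2)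

theorem pow_apply_w_eq_zero {i : Fin k} {t : ℕ} (h : J.d i < t) : (e ^ t) (J.w i) = 0 :=
  pow_apply_eq_zero_of_le (J.pow_apply_eq_zero i) h

theorem coordAt_pow (j i : Fin k) (s t : ℕ) :
    J.coordAt j s ((e ^ t) (J.w i)) = if j = i ∧ s = t ∧ s ≤ J.d i then 1 else 0 := by
  by_cases ht : t < J.d i + 1
  · rw [← J.basis_apply i ⟨t, ht⟩]
    by_cases hs : s < J.d j + 1
    · rw [coordAt_eq_repr J hs, Basis.repr_self, Finsupp.single_apply]
      refine if_congr ⟨fun h => ?_, ?_⟩ rfl rfl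
      · rw [Sigma.mk.injEq] at h
        obtain ⟨rfl, h⟩ := h
        have := congrArg Fin.val (eq_of_heq h)
        simp only at this
        omega
      · rintro ⟨rfl, rfl, -⟩
        rfl
    · rw [coordAt_of_lt J (by omega), LinearMap.zero_apply, if_neg]
      rintro ⟨rfl, rfl, h⟩
      omega
  · rw [J.pow_apply_w_eq_zero (by omega), map_zero, if_neg]
    rintro ⟨rfl, rfl, h⟩
    omega

theorem coordAt_pow_apply (j : Fin k) (s t : ℕ) (x : V) :
    J.coordAt j s ((e ^ t) x) = if t ≤ s ∧ s ≤ J.d j then J.coordAt j (s - t) x else 0 := by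
  have : J.coordAt j s ∘ₗ (e ^ t) =
      if t ≤ s ∧ s ≤ J.d j then J.coordAt j (s - t) else 0 := by
    refine J.basis.ext fun p => ?_
    rw [J.basis_apply, LinearMap.comp_apply, ← Module.End.mul_apply, ← pow_add, coordAt_pow]
    split_ifs with h1 h2 h2
    · obtain ⟨h, h', h''⟩ := h1
      rw [coordAt_pow, if_pos ⟨h, by omega, by omega⟩]
    · obtain ⟨rfl, h', h''⟩ := h1
      omega
    · rw [coordAt_pow, if_neg]
      rintro ⟨rfl, h', h''⟩
      exact h1 ⟨rfl, by omega, by omega⟩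
    · rfl
  rw [← LinearMap.comp_apply, this]
  split_ifs <;> rfl

/-- The endomorphism `e ^ s (w j) ↦ e ^ (s + t) (w i)` that annihilates all blocks except the
`j`-th. -/
noncomputable def elementary (j i : Fin k) (t : ℕ) : End K V :=
  J.basis.constr K fun p => if p.1 = j then (e ^ ((p.2 : ℕ) + t)) (J.w i) else 0

theorem elementary_pow_apply {j i : Fin k} {t : ℕ} (ht : J.d i ≤ J.d j + t) (l : Fin k) (r : ℕ) :
    J.elementary j i t ((e ^ r) (J.w l)) = if l = j then (e ^ (r + t)) (J.w i) else 0 := by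
  by_cases hr : r < J.d l + 1
  · rw [← J.basis_apply l ⟨r, hr⟩, elementary, Basis.constr_basis]
  · rw [J.pow_apply_w_eq_zero (by omega), map_zero]
    split_ifs with h
    · subst h
      rw [J.pow_apply_w_eq_zero (by omega)]
    · rfl

theorem mul_elementary {j i : Fin k} {t : ℕ} (ht : J.d i ≤ J.d j + t) :
    e * J.elementary j i t = J.elementary j i t * e := by
  refine J.basis.ext fun p => ?_
  rw [J.basis_apply]
  change e (J.elementary j i t ((e ^ (p.2 : ℕ)) (J.w p.1))) =
    J.elementary j i t (e ((e ^ (p.2 : ℕ)) (J.w p.1)))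
  rw [← Module.End.mul_apply e (e ^ (p.2 : ℕ)), ← pow_succ', elementary_pow_apply J ht,
    elementary_pow_apply J ht]
  split_ifs with h
  · rw [← Module.End.mul_apply, ← pow_succ']
    congr 2
    ring
  · rw [map_zero]

theorem coordAt_elementary_apply {j i : Fin k} {t : ℕ} (ht : J.d i ≤ J.d j + t) (l : Fin k)
    (x : V) : J.coordAt l (J.d l) (J.elementary j i t x) =
      if l = i ∧ t ≤ J.d l then J.coordAt j (J.d l - t) x else 0 := by
  have : J.coordAt l (J.d l) ∘ₗ J.elementary j i t =
      if l = i ∧ t ≤ J.d l then J.coordAt j (J.d l - t) else 0 := by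
    refine J.basis.ext fun p => ?_
    have hp := p.2.2
    rw [J.basis_apply, LinearMap.comp_apply, elementary_pow_apply J ht]
    by_cases hpj : p.1 = j
    · rw [if_pos hpj, coordAt_pow]
      split_ifs with h1 h2 h2
      · obtain ⟨h, h', h''⟩ := h1
        rw [coordAt_pow, if_pos ⟨hpj.symm, by omega, by omega⟩]
      · omega
      · rw [coordAt_pow, if_neg]
        rintro ⟨h, h', h''⟩
        exact h1 ⟨h2.1, by omega, by rw [h2.1]⟩
      · rfl
    · rw [if_neg hpj, map_zero]
      split_ifs with h2
      · rw [coordAt_pow, if_neg fun h => hpj h.1.symm]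
      · rfl
  rw [← LinearMap.comp_apply, this]
  split_ifs <;> rfl

theorem alpha_apply (a : Fin k → K) (φ : centralizer K e) :
    J.alpha a φ = ∑ i, a i * J.coordAt i (J.d i) ((φ : End K V) (J.w i)) := by
  simp only [alpha, LinearMap.coe_mk, AddHom.coe_mk, coeff,
    coordAt_eq_repr J (Nat.lt_succ_self (J.d _))]
  rfl

theorem comm_pow_apply {φ : End K V} (hφ : e * φ = φ * e) (t : ℕ) (x : V) :
    φ ((e ^ t) x) = (e ^ t) (φ x) := by
  rw [← Module.End.mul_apply, ← Module.End.mul_apply, ((show Commute e φ from hφ).pow_left t).eq]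

/-- The conditions on the coefficients of an element of the stabiliser of `α` that are obtained by
testing against the elementary endomorphisms. -/
theorem mul_coordAt_eq (a : Fin k → K) {φ : centralizer K e}
    (hφ : φ ∈ coadjointStabilizer (J.alpha a)) {i j : Fin k} {t : ℕ} (ht : J.d i ≤ J.d j + t) :
    a j * (if t ≤ J.d j then J.coordAt j (J.d j - t) ((φ : End K V) (J.w i)) else 0) =
      a i * if t ≤ J.d i then J.coordAt j (J.d i - t) ((φ : End K V) (J.w i)) else 0 := by
  have hcomm : e * (φ : End K V) = φ * e := lie_eq_zero_iff_mul.1 φ.2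
  have h := hφ ⟨J.elementary j i t, lie_eq_zero_iff_mul.2 (J.mul_elementary ht)⟩
  rw [alpha_apply] at h
  change ∑ l, a l * J.coordAt l (J.d l) (((φ : End K V) * J.elementary j i t -
    J.elementary j i t * (φ : End K V)) (J.w l)) = 0 at h
  simp only [LinearMap.sub_apply, Module.End.mul_apply, map_sub, mul_sub,
    Finset.sum_sub_distrib] at h
  rw [sub_eq_zero, Finset.sum_eq_single j, Finset.sum_eq_single i] at h
  · have hw := J.elementary_pow_apply ht j 0
    rw [pow_zero, Module.End.one_apply, if_pos rfl, zero_add] at hw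
    rw [hw, comm_pow_apply hcomm, coordAt_pow_apply, coordAt_elementary_apply J ht] at h
    simpa using h
  · intro l _ hl
    rw [coordAt_elementary_apply J ht, if_neg fun h => hl h.1, mul_zero]
  · simp
  · intro l _ hl
    have hw := J.elementary_pow_apply ht l 0
    rw [pow_zero, Module.End.one_apply, if_neg hl] at hw
    rw [hw, map_zero, map_zero, mul_zero]
  · simp

/-- The elements of the stabiliser of `α` in the centraliser of `e` in `gl(V)` have no components
between different blocks. Only the coefficients `a j` of blocks that are not of minimal
dimension need to be non-zero. -/
theorem coordAt_eq_zero_of_mem_stabilizer {a : Fin k → K}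
    (hne : ∀ i j, i ≠ j → J.d i = J.d j → a i ≠ a j) (h0 : ∀ i j, J.d i < J.d j → a j ≠ 0)
    {φ : centralizer K e} (hφ : φ ∈ coadjointStabilizer (J.alpha a)) {i j : Fin k} (hij : i ≠ j)
    (s : ℕ) : J.coordAt j s ((φ : End K V) (J.w i)) = 0 := by
  induction s using Nat.strong_induction_on with
  | _ s ih =>
    by_cases hs : J.d j < s
    · rw [coordAt_of_lt J hs, LinearMap.zero_apply]
    rcases lt_trichotomy (J.d i) (J.d j) with hd | hd | hd
    · have h := J.mul_coordAt_eq a hφ (i := i) (j := j) (t := J.d j - s) (by omega)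
      rw [if_pos (by omega), Nat.sub_sub_self (by omega)] at h
      refine (mul_eq_zero.1 (h.trans ?_)).resolve_left (h0 i j hd)
      split_ifs
      · rw [ih _ (by omega), mul_zero]
      · rw [mul_zero]
    · have h := J.mul_coordAt_eq a hφ (i := i) (j := j) (t := J.d j - s) (by omega)
      rw [if_pos (by omega), if_pos (by omega), hd, Nat.sub_sub_self (by omega), ← sub_eq_zero,
        ← sub_mul] at h
      exact (mul_eq_zero.1 h).resolve_left (sub_ne_zero.2 (hne i j hij hd).symm)
    · have h := J.mul_coordAt_eq a hφ (i := i) (j := j) (t := J.d i - s) (by omega)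
      rw [if_pos (show J.d i - s ≤ J.d i by omega), Nat.sub_sub_self (by omega)] at h
      refine (mul_eq_zero.1 (h.symm.trans ?_)).resolve_left (h0 j i hd)
      split_ifs
      · rw [ih _ (by omega), mul_zero]
      · rw [mul_zero]

theorem finrank_eq : finrank K V = Fintype.card (Σ i, Fin (J.d i + 1)) :=
  finrank_eq_card_basis J.basis

end JordanGenerators

/-- A triangular system of linear equations, with the value `g d` on its diagonal, has only the
trivial solution. -/
theorem eq_zero_of_sum_mul_eq_zero {d : ℕ} {δ g : ℕ → K} (hg : g d ≠ 0) (hg' : ∀ m, d < m → g m = 0)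
    (h : ∀ t, ∑ s ∈ Finset.range (d + 1), δ s * g (s + t) = 0) : ∀ s ≤ d, δ s = 0 := by
  intro s
  induction s using Nat.strong_induction_on with
  | _ s ih =>
    intro hs
    have := h (d - s)
    rw [Finset.sum_eq_single_of_mem s (Finset.mem_range.2 (by omega)),
      Nat.add_sub_cancel' hs] at this
    · exact (mul_eq_zero.1 this).resolve_right hg
    · intro r _ hrs
      rcases lt_or_gt_of_ne hrs with hr | hr
      · rw [ih r hr (by omega), zero_mul]
      · rw [hg' _ (by omega), mul_zero]

/-- A subspace that some injective endomorphism moves to a disjoint one has at most half the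
dimension of the whole space. -/
theorem two_mul_finrank_le_of_disjoint_map [FiniteDimensional K V] {P : Submodule K V}
    {T : End K V} (hT : Function.Injective T) (hP : ∀ x ∈ P, T x ∈ P → x = 0) :
    2 * finrank K P ≤ finrank K V := by
  have h1 : finrank K (P.map T) = finrank K P :=
    (Submodule.equivMapOfInjective T hT P).finrank_eq.symm
  have h2 : Disjoint P (P.map T) := by
    rw [Submodule.disjoint_def]
    rintro _ hx ⟨y, hy, rfl⟩
    rw [hP y hy hx, map_zero]
  have := Submodule.finrank_add_finrank_le_of_disjoint h2
  omega

namespace SymplecticJordanGenerators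

variable {ω : LinearMap.BilinForm K V} {e : End K V} {k : ℕ}
  (J : SymplecticJordanGenerators ω e k)

theorem even_d_iff (i : Fin k) : Even (J.d i) ↔ J.pair i ≠ i := by
  rw [Ne, J.pair_eq_self_iff, Nat.not_even_iff_odd, Nat.odd_add_one, Nat.not_odd_iff_even]

theorem apply_w_pow_ne_zero (he : e ∈ sp ω) (hω : ω.Nondegenerate) (halt : ω.IsAlt) (i : Fin k) :
    ω (J.w (J.pair i)) ((e ^ J.d i) (J.w i)) ≠ 0 := by
  intro h
  refine J.basis.ne_zero ⟨i, Fin.last _⟩ (hω.1 _ ?_)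
  rw [J.basis_apply]
  have : ω ((e ^ J.d i) (J.w i)) = 0 := by
    refine J.basis.ext fun p => ?_
    rw [J.basis_apply, LinearMap.zero_apply]
    by_cases hp : p.1 = J.pair i
    · rw [apply_pow_pow_of_mem_sp he]
      rcases Nat.eq_zero_or_pos (p.2 : ℕ) with h0 | h0
      · rw [h0, zero_add, hp, ← halt.neg_eq, h, neg_zero, mul_zero]
      · rw [J.pow_apply_w_eq_zero (by omega), map_zero, LinearMap.zero_apply, mul_zero]
    · exact J.orthogonal _ _ hp _ _
  intro u
  simpa using LinearMap.congr_fun this u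

/-- Only the component in the partner block contributes to the pairing with a block. -/
theorem apply_pow_w_eq_sum (x : V) (j : Fin k) (t : ℕ) :
    ω x ((e ^ t) (J.w j)) = ∑ s ∈ Finset.range (J.d j + 1),
      J.coordAt (J.pair j) s x * ω ((e ^ s) (J.w (J.pair j))) ((e ^ t) (J.w j)) := by
  conv_lhs => rw [← J.basis.sum_repr x]
  rw [map_sum, LinearMap.sum_apply, Fintype.sum_sigma, Finset.sum_eq_single (J.pair j),
    Finset.sum_range, ← J.d_pair j]
  · refine Finset.sum_congr rfl fun s _ => ?_
    rw [map_smul, LinearMap.smul_apply, J.basis_apply, J.coordAt_eq_repr s.2, smul_eq_mul]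
  · intro i _ hi
    refine Finset.sum_eq_zero fun s _ => ?_
    rw [map_smul, LinearMap.smul_apply, J.basis_apply, J.orthogonal, smul_zero]
    rintro rfl
    exact hi (J.pair_pair i).symm
  · simp

variable [FiniteDimensional K V]

/-- The block-diagonal coefficients of the adjoint of an endomorphism commuting with `e`. -/
theorem coordAt_adj (he : e ∈ sp ω) (hω : ω.Nondegenerate) (halt : ω.IsAlt) {φ : End K V}
    (hφ : e * φ = φ * e) (i : Fin k) {s : ℕ} (hs : s ≤ J.d i) :
    J.coordAt (J.pair i) s (adj hω φ (J.w (J.pair i))) =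
      (-1) ^ s * J.coordAt i s (φ (J.w i)) := by
  have key := eq_zero_of_sum_mul_eq_zero (d := J.d i)
    (δ := fun s => (-1) ^ s * J.coordAt (J.pair i) s (adj hω φ (J.w (J.pair i))) -
      J.coordAt i s (φ (J.w i)))
    (g := fun m => ω (J.w (J.pair i)) ((e ^ m) (J.w i)))
    (J.apply_w_pow_ne_zero he hω halt i)
    (fun m hm => by rw [J.pow_apply_w_eq_zero hm, map_zero])
    (fun t => by
      have e1 := J.apply_pow_w_eq_sum (adj hω φ (J.w (J.pair i))) i t
      have e2 := J.apply_pow_w_eq_sum (φ (J.w i)) (J.pair i) t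
      rw [apply_adj_left, JordanGenerators.comm_pow_apply hφ] at e1
      have e3 : ω (J.w (J.pair i)) ((e ^ t) (φ (J.w i))) =
          -(-1) ^ t * ω (φ (J.w i)) ((e ^ t) (J.w (J.pair i))) := by
        rw [← halt.neg_eq ((e ^ t) (φ (J.w i))), apply_pow_of_mem_sp he, neg_mul]
      rw [e3, e2, Finset.mul_sum, J.pair_pair, J.d_pair] at e1
      simp only [sub_mul, Finset.sum_sub_distrib, sub_eq_zero]
      refine Eq.trans (Finset.sum_congr rfl fun s _ => ?_)
        (e1.symm.trans (Finset.sum_congr rfl fun s _ => ?_))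
      · rw [apply_pow_of_mem_sp he, ← Module.End.mul_apply, ← pow_add]
        ring
      · rw [← halt.neg_eq, apply_pow_of_mem_sp he t, ← Module.End.mul_apply, ← pow_add,
          add_comm t s]
        rcases neg_one_pow_eq_or K t with h | h <;> rw [h] <;> ring) s hs
  rw [← sub_eq_zero.1 key, ← mul_assoc, ← mul_pow]
  simp

theorem adj_comm (he : e ∈ sp ω) (hω : ω.Nondegenerate) {φ : End K V} (hφ : e * φ = φ * e) :
    e * adj hω φ = adj hω φ * e := by
  have := congrArg (adj hω) hφ
  rw [adj_mul, adj_mul, (mem_sp_iff_adj hω).1 he, mul_neg, neg_mul, neg_inj] at this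
  exact this.symm

theorem alpha_adj (he : e ∈ sp ω) (hω : ω.Nondegenerate) (halt : ω.IsAlt) {a : Fin k → K}
    (ha : ∀ i, Odd (J.d i + 1) → a (J.pair i) = - a i) {φ : End K V} (hφ : e * φ = φ * e) :
    J.alpha a ⟨adj hω φ, lie_eq_zero_iff_mul.2 (adj_comm he hω hφ)⟩ =
      - J.alpha a ⟨φ, lie_eq_zero_iff_mul.2 hφ⟩ := by
  rw [J.alpha_apply, J.alpha_apply, ← Finset.sum_neg_distrib,
    ← Equiv.sum_comp (⟨J.pair, J.pair, J.pair_pair, J.pair_pair⟩ : Fin k ≃ Fin k)]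
  refine Finset.sum_congr rfl fun i _ => ?_
  simp only [Equiv.coe_fn_mk]
  rw [J.d_pair, J.coordAt_adj he hω halt hφ i le_rfl]
  rcases Nat.even_or_odd (J.d i) with h | h
  · rw [ha i h.add_one, h.neg_one_pow]
    ring
  · rw [(J.pair_eq_self_iff i).2 h.add_one, h.neg_one_pow]
    ring

end SymplecticJordanGenerators

variable {ω : LinearMap.BilinForm K V} {e : sp ω} {k : ℕ}
  (J : SymplecticJordanGenerators ω (e : End K V) k)

/-- The possible block-diagonal coefficients of skew-adjoint endomorphisms commuting with `e`. -/
def skewCoeffs : Submodule K ((Σ i, Fin (J.d i + 1)) → K) where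
  carrier := {c | ∀ i s (hs : s < J.d i + 1) (hs' : s < J.d (J.pair i) + 1),
    c ⟨J.pair i, ⟨s, hs'⟩⟩ = -(-1) ^ s * c ⟨i, ⟨s, hs⟩⟩}
  zero_mem' := by simp
  add_mem' := by
    intro c c' hc hc' i s hs hs'
    rw [Pi.add_apply, Pi.add_apply, hc i s hs hs', hc' i s hs hs', mul_add]
  smul_mem' := by
    intro r c hc i s hs hs'
    rw [Pi.smul_apply, Pi.smul_apply, hc i s hs hs', smul_eq_mul, smul_eq_mul, mul_left_comm]

/-- Reversing the order of the coefficients within each block, together with a change of sign in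
one block of each pair, moves the space of coefficients to a disjoint one. -/
theorem two_mul_finrank_skewCoeffs_le (h2 : (2 : K) ≠ 0) :
    2 * finrank K (skewCoeffs J) ≤ finrank K V := by
  let η : Fin k → K := fun i => if J.pair i < i then -1 else 1
  have hη : ∀ i, η i ≠ 0 := fun i => by
    simp only [η]
    split_ifs <;> simp
  let T : End K ((Σ i, Fin (J.d i + 1)) → K) :=
    { toFun := fun c p => η p.1 * c ⟨p.1, Fin.rev p.2⟩
      map_add' := fun c c' => by ext p; simp [mul_add]
      map_smul' := fun r c => by ext p; simp [mul_left_comm] }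
  have hT : ∀ c i s, T c ⟨i, s⟩ = η i * c ⟨i, Fin.rev s⟩ := fun _ _ _ => rfl
  have hηpair : ∀ i, η (J.pair i) * (-1) ^ J.d i - η i ≠ 0 := by
    intro i
    rcases Nat.even_or_odd (J.d i) with h | h
    · have hne := (J.even_d_iff i).1 h
      rw [h.neg_one_pow]
      simp only [η, J.pair_pair]
      rcases lt_or_gt_of_ne hne with h' | h'
      · rw [if_neg h'.not_gt, if_pos h']
        convert h2 using 1
        ring
      · rw [if_pos h', if_neg h'.not_gt]
        convert neg_ne_zero.2 h2 using 1
        ring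
    · rw [h.neg_one_pow]
      simp only [η, (J.pair_eq_self_iff i).2 h.add_one, lt_irrefl, if_false]
      convert neg_ne_zero.2 h2 using 1
      ring
  rw [J.finrank_eq, ← finrank_fintype_fun_eq_card K]
  refine two_mul_finrank_le_of_disjoint_map (T := T) ?_ ?_
  · intro c c' h
    funext p
    have := congrFun h ⟨p.1, Fin.rev p.2⟩
    rw [hT, hT, Fin.rev_rev] at this
    exact mul_left_cancel₀ (hη _) this
  · intro c hc hTc
    funext p
    obtain ⟨i, s, hs⟩ := p
    have hdi := J.d_pair i
    have h1 := hTc i (J.d i - s) (by omega) (by omega)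
    have h3 := hc i s hs (by omega)
    have r1 : Fin.rev (⟨J.d i - s, by omega⟩ : Fin (J.d (J.pair i) + 1)) = ⟨s, by omega⟩ := by
      ext; simp; omega
    have r2 : Fin.rev (⟨J.d i - s, by omega⟩ : Fin (J.d i + 1)) = ⟨s, hs⟩ := by
      ext; simp; omega
    rw [hT, hT, r1, r2, h3] at h1
    have h4 : (-1 : K) ^ (J.d i - s) = (-1) ^ J.d i * (-1) ^ s := by
      rw [← pow_add]
      apply neg_one_pow_congr
      rw [Nat.even_iff, Nat.even_iff]
      omega
    rw [h4] at h1
    have h5 : (η (J.pair i) * (-1) ^ J.d i - η i) * c ⟨i, ⟨s, hs⟩⟩ = 0 := by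
      have hsq : ((-1 : K) ^ J.d i) ^ 2 = 1 := by rw [← pow_mul, mul_comm, pow_mul]; simp
      have hsq' : ((-1 : K) ^ s) ^ 2 = 1 := by rw [← pow_mul, mul_comm, pow_mul]; simp
      linear_combination (-(-1 : K) ^ s * (-1) ^ J.d i) * h1 +
        (-η (J.pair i) * (-1) ^ J.d i * c ⟨i, ⟨s, hs⟩⟩ +
          η i * c ⟨i, ⟨s, hs⟩⟩ * ((-1 : K) ^ J.d i) ^ 2) * hsq' +
        (η i * c ⟨i, ⟨s, hs⟩⟩) * hsq
    exact (mul_eq_zero.1 h5).resolve_left (hηpair i)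

variable [FiniteDimensional K V]

/-- As `α` changes sign under the adjoint involution, it vanishes on the brackets of skew-adjoint
with self-adjoint elements. So its stabiliser in `sp(V)` is determined by its restriction. -/
theorem map_stabilizer_restrictCovector (h2 : (2 : K) ≠ 0) (hω : ω.Nondegenerate)
    (halt : ω.IsAlt) {a : Fin k → K} (ha : ∀ i, Odd (J.d i + 1) → a (J.pair i) = - a i) :
    (coadjointStabilizer (restrictCovector ω e (J.alpha a))).map
        ((sp ω).incl.comp (centralizer K e).incl) =
      (coadjointStabilizer (J.alpha a)).map (centralizer K (e : End K V)).incl ⊓ sp ω := by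
  ext x
  rw [mem_map_coadjointStabilizer, LieSubalgebra.mem_inf]
  constructor
  · rintro ⟨hx, hc, hst⟩
    have hcx : ⁅(e : End K V), x⁆ = 0 := congrArg Subtype.val hc
    refine ⟨⟨⟨x, hcx⟩, fun φ => ?_, rfl⟩, hx⟩
    obtain ⟨φ, hφ⟩ := φ
    have hφ' : (e : End K V) * φ = φ * e := lie_eq_zero_iff_mul.1 hφ
    have hσ : ⁅(e : End K V), adj hω φ⁆ = 0 :=
      lie_eq_zero_iff_mul.2 (SymplecticJordanGenerators.adj_comm e.2 hω hφ')
    set ψ : centralizer K (e : End K V) := ⟨φ, hφ⟩ with hψ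
    set σ : centralizer K (e : End K V) := ⟨adj hω φ, hσ⟩ with hσdef
    set X : centralizer K (e : End K V) := ⟨x, hcx⟩ with hX
    have h1 : J.alpha a ⁅X, ψ - σ⁆ = 0 :=
      hst ⟨⟨φ - adj hω φ, sub_adj_mem_sp hω halt φ⟩, Subtype.ext (ψ - σ).2⟩
    have h3 : J.alpha a ⁅X, ψ + σ⁆ = 0 := by
      have hcomm := lie_eq_zero_iff_mul.1 ⁅X, ψ + σ⁆.2
      have := J.alpha_adj e.2 hω halt ha hcomm
      have hfix : adj hω (⁅X, ψ + σ⁆ : centralizer K (e : End K V)) =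
          ((⁅X, ψ + σ⁆ : centralizer K (e : End K V)) : End K V) := by
        change adj hω (x * (φ + adj hω φ) - (φ + adj hω φ) * x) =
          x * (φ + adj hω φ) - (φ + adj hω φ) * x
        rw [map_sub, adj_mul, adj_mul, add_adj_eq hω halt, (mem_sp_iff_adj hω).1 hx]
        noncomm_ring
      simp only [hfix] at this
      have h4 : J.alpha a ⁅X, ψ + σ⁆ = - J.alpha a ⁅X, ψ + σ⁆ := this
      have h5 : (2 : K) * J.alpha a ⁅X, ψ + σ⁆ = 0 := by
        rw [two_mul]
        nth_rewrite 1 [h4]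
        exact neg_add_cancel _
      exact (mul_eq_zero.1 h5).resolve_left h2
    have h6 : (2 : K) * J.alpha a ⁅X, ψ⁆ = 0 := by
      rw [lie_sub, map_sub] at h1
      rw [lie_add, map_add] at h3
      linear_combination h1 + h3
    exact (mul_eq_zero.1 h6).resolve_left h2
  · rintro ⟨⟨⟨x, hcx⟩, hst, rfl⟩, hx⟩
    exact ⟨hx, Subtype.ext hcx, fun y => hst (centralizerInclusion ω e y)⟩

theorem two_mul_finrank_stabilizer_restrictCovector_le (h2 : (2 : K) ≠ 0) (hω : ω.Nondegenerate)
    (halt : ω.IsAlt) {a : Fin k → K} (ha : ∀ i, Odd (J.d i + 1) → a (J.pair i) = - a i)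
    (hne : ∀ i j, i ≠ j → J.d i = J.d j → a i ≠ a j) (h0 : ∀ i j, J.d i < J.d j → a j ≠ 0) :
    2 * finrank K (coadjointStabilizer (restrictCovector ω e (J.alpha a))) ≤ finrank K V := by
  refine le_trans ?_ (two_mul_finrank_skewCoeffs_le J h2)
  rw [finrank_coadjointStabilizer_eq, map_stabilizer_restrictCovector J h2 hω halt ha]
  set M := (coadjointStabilizer (J.alpha a)).map (centralizer K (e : End K V)).incl ⊓ sp ω
  have hM : ∀ x ∈ M, x ∈ sp ω ∧ (e : End K V) * x = x * e ∧
      ∀ i j, i ≠ j → ∀ s, J.coordAt j s (x (J.w i)) = 0 := by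
    rintro _ ⟨⟨φ, hφ, rfl⟩, hx⟩
    exact ⟨hx, lie_eq_zero_iff_mul.1 φ.2,
      fun i j hij s => J.coordAt_eq_zero_of_mem_stabilizer hne h0 hφ hij s⟩
  let f : M →ₗ[K] skewCoeffs J := LinearMap.codRestrict _
    { toFun := fun x p => J.coordAt p.1 p.2 ((x : End K V) (J.w p.1))
      map_add' := fun x y => by ext p; simp
      map_smul' := fun r x => by ext p; simp } (by
        intro x i s hs hs'
        obtain ⟨hx, hex, -⟩ := hM x x.2
        have h := J.coordAt_adj e.2 hω halt hex i (Nat.lt_succ_iff.1 hs)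
        rw [(mem_sp_iff_adj hω).1 hx, LinearMap.neg_apply, map_neg, neg_eq_iff_eq_neg] at h
        rw [neg_mul]
        exact h)
  refine Nat.mul_le_mul_left 2 (LinearMap.finrank_le_finrank_of_injective (f := f) ?_)
  rw [← LinearMap.ker_eq_bot, LinearMap.ker_eq_bot']
  intro x hx
  obtain ⟨-, hex, hoff⟩ := hM x x.2
  have hw : ∀ i, (x : End K V) (J.w i) = 0 := by
    intro i
    refine J.ext_coordAt fun j s hs => ?_
    rw [map_zero]
    by_cases hij : i = j
    · subst hij
      exact congrFun (congrArg Subtype.val hx) ⟨i, ⟨s, Nat.lt_succ_of_le hs⟩⟩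
    · exact hoff i j hij s
  refine Subtype.ext (J.basis.ext fun p => ?_)
  rw [J.basis_apply, JordanGenerators.comm_pow_apply hex, hw, map_zero]
  rfl

end Stabilizer

/-! ### The index of the centraliser -/

section Index

variable {K V : Type*} [Field K] [AddCommGroup V] [Module K V]
  {ω : LinearMap.BilinForm K V}

/-- Over a field with at least `k` elements there is a choice of the coefficients `a i` for which
`α` has a stabiliser of minimal dimension. If all blocks have the same even dimension, then zero
may be among the coefficients; otherwise they are non-zero and chosen greedily. -/
theorem exists_coefficients (h2 : (2 : K) ≠ 0) {e : End K V} {k : ℕ}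
    (J : SymplecticJordanGenerators ω e k) (hk : (k : Cardinal) ≤ Cardinal.mk K) :
    ∃ a : Fin k → K, (∀ i, Odd (J.d i + 1) → a (J.pair i) = - a i) ∧
      (∀ i j, i ≠ j → J.d i = J.d j → a i ≠ a j) ∧ ∀ i j, J.d i < J.d j → a j ≠ 0 := by
  classical
  obtain ⟨S, hS⟩ := Cardinal.exists_finset_le_card K k hk
  by_cases hA : ∀ i, Odd (J.d i) ∧ ∀ j, J.d i = J.d j
  · obtain ⟨f⟩ : Nonempty (Fin k ↪ S) :=
      Function.Embedding.nonempty_of_card_le (by simpa using hS)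
    refine ⟨fun i => f i, fun i hi => ?_, fun i j hij _ h => hij ?_, fun i j hij => ?_⟩
    · exact absurd (hA i).1.add_one (Nat.not_even_iff_odd.2 hi)
    · exact f.injective (Subtype.ext h)
    · exact absurd ((hA i).2 j) hij.ne
  -- `j` is an index whose coefficient need not be avoided when the coefficient of `i` is chosen
  have hother : ∀ i, ∃ j, j ≠ i ∧ (j = J.pair i ∨ J.d j ≠ J.d i) := by
    intro i
    by_cases hp : J.pair i = i
    · have hodd : Odd (J.d i) := by
        rw [← Nat.not_even_iff_odd, J.even_d_iff]
        exact not_not.2 hp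
      by_contra! hc
      have hall : ∀ j, J.d j = J.d i := by
        intro j
        by_cases hj : j = i
        · rw [hj]
        · exact (hc j hj).2
      exact hA fun j => ⟨(hall j).symm ▸ hodd, fun l => (hall j).trans (hall l).symm⟩
    · exact ⟨J.pair i, hp, Or.inl rfl⟩
  have key : ∀ m, ∀ t : Finset (Fin k), t.card = m → (∀ i ∈ t, J.pair i ∈ t) →
      ∃ a : Fin k → K, (∀ i ∈ t, a i ≠ 0) ∧
        (∀ i ∈ t, J.pair i ≠ i → a (J.pair i) = - a i) ∧
        ∀ i ∈ t, ∀ j ∈ t, i ≠ j → J.d i = J.d j → a i ≠ a j := by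
    intro m
    induction m using Nat.strong_induction_on with
    | _ m ih =>
      intro t htm ht
      rcases t.eq_empty_or_nonempty with rfl | ⟨i, hi⟩
      · exact ⟨0, by simp⟩
      set t' := (t.erase i).erase (J.pair i) with ht'
      have hmem : ∀ l, l ∈ t' ↔ l ≠ J.pair i ∧ l ≠ i ∧ l ∈ t := by simp [ht']
      have hpair : ∀ l l', J.pair l = l' ↔ l = J.pair l' := fun l l' =>
        ⟨fun h => by rw [← h, J.pair_pair], fun h => by rw [h, J.pair_pair]⟩
      have ht'pair : ∀ l ∈ t', J.pair l ∈ t' := by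
        intro l hl
        rw [hmem] at hl ⊢
        exact ⟨fun h => hl.2.1 (by rw [← J.pair_pair l, h, J.pair_pair]),
          fun h => hl.1 ((hpair l i).1 h), ht l hl.2.2⟩
      have hcard : t'.card < m := by
        rw [← htm]
        exact Finset.card_lt_card (Finset.ssubset_iff_of_subset
          (fun l hl => ((hmem l).1 hl).2.2) |>.2 ⟨i, hi, fun h => ((hmem i).1 h).2.1 rfl⟩)
      obtain ⟨a, ha0, hapair, hane⟩ := ih _ hcard t' rfl ht'pair
      set F : Finset K := insert 0 ((t'.filter fun l => J.d l = J.d i).image a) with hF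
      have hFcard : F.card < S.card := by
        obtain ⟨j, hji, hj⟩ := hother i
        have hsub : (t'.filter fun l => J.d l = J.d i) ⊆ (Finset.univ.erase i).erase j := by
          intro l hl
          rw [Finset.mem_filter, hmem] at hl
          simp only [Finset.mem_erase, Finset.mem_univ, and_true]
          refine ⟨?_, hl.1.2.1⟩
          rintro rfl
          rcases hj with hj | hj
          · exact hl.1.1 hj
          · exact hj hl.2
        have h1 := Finset.card_le_card hsub
        rw [Finset.card_erase_of_mem (by simp [hji]), Finset.card_erase_of_mem (by simp),
          Finset.card_univ, Fintype.card_fin] at h1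
        have h3 : F.card ≤ (t'.filter fun l => J.d l = J.d i).card + 1 :=
          (Finset.card_insert_le 0 _).trans (Nat.add_le_add_right Finset.card_image_le 1)
        have hk2 : 2 ≤ k := by
          have := Finset.card_le_univ ({i, j} : Finset (Fin k))
          rwa [Finset.card_pair hji.symm, Fintype.card_fin] at this
        omega
      obtain ⟨x, -, hx⟩ := Finset.exists_mem_notMem_of_card_lt_card hFcard
      have hx0 : x ≠ 0 := fun h => hx (by simp [hF, h])
      have hxa : ∀ l ∈ t', J.d l = J.d i → a l ≠ x := fun l hl hd h =>
        hx (Finset.mem_insert_of_mem (Finset.mem_image.2 ⟨l, Finset.mem_filter.2 ⟨hl, hd⟩, h⟩))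
      have hxx : -x ≠ x := by
        intro h
        have : 2 * x = 0 := by linear_combination -h
        exact (mul_ne_zero h2 hx0) this
      have hxa' : J.pair i ≠ i → ∀ l ∈ t', J.d l = J.d i → a l ≠ -x := by
        intro hp l hl hd h
        have hl' : J.pair l ≠ l := by
          rw [← J.even_d_iff, hd, J.even_d_iff]
          exact hp
        exact hxa _ (ht'pair l hl) (by rw [J.d_pair, hd]) (by rw [hapair l hl hl', h, neg_neg])
      let a' : Fin k → K := fun l => if l = i then x else if l = J.pair i then -x else a l
      have ha'i : a' i = x := if_pos rfl
      have ha'p : J.pair i ≠ i → a' (J.pair i) = -x := fun h => by simp [a', h]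
      have ha't : ∀ l ∈ t', a' l = a l := fun l hl => by
        rw [hmem] at hl
        simp [a', hl.1, hl.2.1]
      have hcases : ∀ l ∈ t, l = i ∨ (J.pair i ≠ i ∧ l = J.pair i) ∨ l ∈ t' := by
        intro l hl
        by_cases h1 : l = i
        · exact Or.inl h1
        · by_cases h3 : l = J.pair i
          · exact Or.inr (Or.inl ⟨fun h => h1 (h3.trans h), h3⟩)
          · exact Or.inr (Or.inr ((hmem l).2 ⟨h3, h1, hl⟩))
      refine ⟨a', ?_, ?_, ?_⟩
      · intro l hl
        rcases hcases l hl with rfl | ⟨hp, rfl⟩ | hl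
        · rwa [ha'i]
        · rw [ha'p hp]
          exact neg_ne_zero.2 hx0
        · rw [ha't l hl]
          exact ha0 l hl
      · intro l hl hlp
        rcases hcases l hl with rfl | ⟨hp, rfl⟩ | hl
        · rw [ha'i, ha'p hlp]
        · rw [J.pair_pair, ha'i, ha'p hp, neg_neg]
        · rw [ha't l hl, ha't _ (ht'pair l hl)]
          exact hapair l hl hlp
      · intro l hl l' hl' hne hd
        rcases hcases l hl with rfl | ⟨hp, rfl⟩ | hl <;>
        rcases hcases l' hl' with rfl | ⟨hp', rfl⟩ | hl'
        · exact absurd rfl hne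
        · rw [ha'i, ha'p hp']
          exact hxx.symm
        · rw [ha'i, ha't l' hl']
          exact (hxa l' hl' hd.symm).symm
        · rw [ha'i, ha'p hp]
          exact hxx
        · exact absurd rfl hne
        · rw [ha'p hp, ha't l' hl']
          rw [J.d_pair] at hd
          exact (hxa' hp l' hl' hd.symm).symm
        · rw [ha'i, ha't l hl]
          exact hxa l hl hd
        · rw [ha'p hp', ha't l hl]
          rw [J.d_pair] at hd
          exact hxa' hp' l hl hd
        · rw [ha't l hl, ha't l' hl']
          exact hane l hl l' hl' hne hd
  obtain ⟨a, ha0, hap, hane⟩ := key _ Finset.univ rfl fun _ _ => Finset.mem_univ _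
  refine ⟨a, fun i hi => hap i (Finset.mem_univ _) ?_,
    fun i j => hane i (Finset.mem_univ _) j (Finset.mem_univ _), fun _ j _ =>
      ha0 j (Finset.mem_univ _)⟩
  rw [Ne, J.pair_eq_self_iff]
  exact Nat.not_even_iff_odd.2 hi

variable [FiniteDimensional K V]

theorem le_finrank_coadjointStabilizer_centralizer (h2 : (2 : K) ≠ 0) (hω : ω.Nondegenerate)
    (halt : ω.IsAlt) {n : ℕ} (hV : finrank K V = 2 * n) (e : sp ω)
    (β : Dual K (centralizer K e)) : n ≤ finrank K (coadjointStabilizer β) := by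
  obtain ⟨h, hh, hind⟩ := exists_linearIndependent_odd_pow hω halt hV
  exact le_finrank_coadjointStabilizer h2 hω halt hh hind e β

/-- The conditions on `a` are weaker than being injective and nowhere zero, as needed for the index
over fields with exactly `k` elements. -/
theorem finrank_stabilizer_restrictCovector (h2 : (2 : K) ≠ 0) (hω : ω.Nondegenerate)
    (halt : ω.IsAlt) {n : ℕ} (hV : finrank K V = 2 * n) {e : sp ω} {k : ℕ}
    (J : SymplecticJordanGenerators ω (e : End K V) k)
    {a : Fin k → K} (ha : ∀ i, Odd (J.d i + 1) → a (J.pair i) = - a i)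
    (hne : ∀ i j, i ≠ j → J.d i = J.d j → a i ≠ a j) (h0 : ∀ i j, J.d i < J.d j → a j ≠ 0) :
    finrank K (coadjointStabilizer (restrictCovector ω e (J.alpha a))) = n := by
  have h1 := two_mul_finrank_stabilizer_restrictCovector_le J h2 hω halt ha hne h0
  have h3 := le_finrank_coadjointStabilizer_centralizer h2 hω halt hV e
    (restrictCovector ω e (J.alpha a))
  omega

theorem index_centralizer_eq (h2 : (2 : K) ≠ 0) (hω : ω.Nondegenerate)
    (halt : ω.IsAlt) {n : ℕ} (hV : finrank K V = 2 * n) {e : sp ω} {k : ℕ}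
    (J : SymplecticJordanGenerators ω (e : End K V) k) (hk : (k : Cardinal) ≤ Cardinal.mk K) :
    index K (centralizer K e) = n := by
  obtain ⟨a, ha, hne, h0⟩ := exists_coefficients h2 J hk
  refine le_antisymm ?_ (le_ciInf fun β =>
    le_finrank_coadjointStabilizer_centralizer h2 hω halt hV e β)
  rw [← finrank_stabilizer_restrictCovector h2 hω halt hV J ha hne h0]
  exact ciInf_le (OrderBot.bddBelow _) _

end Index

/-! ### The rank of the symplectic Lie algebra -/

section Rank

open TensorProduct

variable {K V : Type*} [Field K] [AddCommGroup V] [Module K V]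
  {ω : LinearMap.BilinForm K V}

variable (ω) in
/-- The adjoint representation of `sp(V)`, after extension of scalars. -/
noncomputable def adBaseChange (F : Type*) [Field F] [Algebra K F] :
    F ⊗[K] sp ω →ₗ[F] End F (F ⊗[K] sp ω) :=
  LinearMap.tensorProduct K F (sp ω) (sp ω) ∘ₗ
    LinearMap.baseChange F (LieAlgebra.ad K (sp ω) : sp ω →ₗ[K] End K (sp ω))

variable (ω) in
/-- The inclusion of `sp(V)` in `End V`, after extension of scalars. -/
noncomputable def inclBaseChange (F : Type*) [Field F] [Algebra K F] :
    F ⊗[K] sp ω →ₗ[F] F ⊗[K] End K V :=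
  LinearMap.baseChange F (sp ω).toSubmodule.subtype

variable {F : Type*} [Field F] [Algebra K F]

theorem inclBaseChange_tmul (c : F) (x : sp ω) :
    inclBaseChange ω F (c ⊗ₜ x) = c ⊗ₜ (x : End K V) := rfl

theorem inclBaseChange_injective : Function.Injective (inclBaseChange ω F) :=
  Module.Flat.lTensor_preserves_injective_linearMap (M := F) (sp ω).toSubmodule.subtype
    Subtype.val_injective

theorem inclBaseChange_adBaseChange (x y : F ⊗[K] sp ω) :
    inclBaseChange ω F (adBaseChange ω F x y) =
      inclBaseChange ω F x * inclBaseChange ω F y -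
        inclBaseChange ω F y * inclBaseChange ω F x := by
  induction x using TensorProduct.induction_on with
  | zero => simp
  | add x x' hx hx' => rw [map_add, LinearMap.add_apply, map_add, hx, hx', map_add]; noncomm_ring
  | tmul c x =>
    induction y using TensorProduct.induction_on with
    | zero => simp
    | add y y' hy hy' => rw [map_add, map_add, hy, hy', map_add]; noncomm_ring
    | tmul d y =>
      have : adBaseChange ω F (c ⊗ₜ x) (d ⊗ₜ y) = (c * d) ⊗ₜ[K] ⁅x, y⁆ := by
        simp [adBaseChange, LinearMap.tensorProduct, smul_tmul']
      rw [this, inclBaseChange_tmul, inclBaseChange_tmul, inclBaseChange_tmul,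
        Algebra.TensorProduct.tmul_mul_tmul, Algebra.TensorProduct.tmul_mul_tmul, mul_comm d c,
        ← tmul_sub]
      rfl

variable [FiniteDimensional K V]

theorem baseChange_adj_mul (hω : ω.Nondegenerate) (x y : F ⊗[K] End K V) :
    (adj hω).baseChange F (x * y) = (adj hω).baseChange F y * (adj hω).baseChange F x := by
  induction x using TensorProduct.induction_on with
  | zero => simp
  | add x x' hx hx' => rw [add_mul, map_add, hx, hx', map_add, mul_add]
  | tmul c x =>
    induction y using TensorProduct.induction_on with
    | zero => simp
    | add y y' hy hy' => rw [mul_add, map_add, hy, hy', map_add, add_mul]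
    | tmul d y =>
      simp only [Algebra.TensorProduct.tmul_mul_tmul, LinearMap.baseChange_tmul, adj_mul,
        mul_comm c d]

theorem inclBaseChange_mem_skew (hω : ω.Nondegenerate) (x : F ⊗[K] sp ω) :
    inclBaseChange ω F x ∈ skew ((adj hω).baseChange F) := by
  induction x using TensorProduct.induction_on with
  | zero => simp
  | add x x' hx hx' => rw [map_add]; exact add_mem hx hx'
  | tmul c x =>
    rw [mem_skew, inclBaseChange_tmul, LinearMap.baseChange_tmul, (mem_sp_iff_adj hω).1 x.2,
      tmul_neg]

/-- As `2` is invertible, the skew elements of `F ⊗ End V` come from `F ⊗ sp(V)`. -/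
theorem exists_inclBaseChange_eq (h2 : (2 : K) ≠ 0) (hω : ω.Nondegenerate) (halt : ω.IsAlt)
    {x : F ⊗[K] End K V} (hx : x ∈ skew ((adj hω).baseChange F)) :
    ∃ y, inclBaseChange ω F y = x := by
  let π : End K V →ₗ[K] sp ω :=
    LinearMap.codRestrict (sp ω).toSubmodule ((2 : K)⁻¹ • (LinearMap.id - adj hω))
      fun x => (sp ω).smul_mem _ (sub_adj_mem_sp hω halt x)
  have hπ : ∀ x, inclBaseChange ω F (π.baseChange F x) =
      (2 : K)⁻¹ • (x - (adj hω).baseChange F x) := by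
    intro x
    induction x using TensorProduct.induction_on with
    | zero => simp
    | add x x' hx hx' =>
      rw [map_add, map_add, hx, hx', map_add, ← smul_add]
      congr 1
      abel
    | tmul c x =>
      rw [LinearMap.baseChange_tmul, LinearMap.baseChange_tmul, inclBaseChange_tmul, ← tmul_sub,
        ← tmul_smul]
      rfl
  refine ⟨π.baseChange F x, ?_⟩
  rw [hπ, mem_skew.1 hx, sub_neg_eq_add, ← two_smul K, smul_smul, inv_mul_cancel₀ h2, one_smul]

/-- All elements of `F ⊗ sp(V)` have a centraliser of dimension at least `n`. -/
theorem le_finrank_ker_adBaseChange (h2 : (2 : K) ≠ 0) (hω : ω.Nondegenerate) (halt : ω.IsAlt)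
    {n : ℕ} (hV : finrank K V = 2 * n) (x : F ⊗[K] sp ω) :
    n ≤ finrank F (LinearMap.ker (adBaseChange ω F x)) := by
  obtain ⟨h, hh, hind⟩ := exists_linearIndependent_odd_pow hω halt hV
  have hind' : LinearIndependent F
      fun j : Fin n => ((1 : F) ⊗ₜ[K] h) ^ (2 * (j : ℕ) + 1) := by
    simp only [Algebra.TensorProduct.tmul_pow, one_pow]
    exact Module.Flat.linearIndependent_one_tmul hind
  have h1 : (adj hω).baseChange F (1 : F ⊗[K] End K V) = 1 := by
    rw [Algebra.TensorProduct.one_def, LinearMap.baseChange_tmul, adj_one]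
  have hhS : (1 : F) ⊗ₜ[K] h ∈ skew ((adj hω).baseChange F) := by
    rw [mem_skew, LinearMap.baseChange_tmul, (mem_sp_iff_adj hω).1 hh, tmul_neg]
  obtain ⟨W, hW, hWmem⟩ := exists_deformable_centralizer h1 (baseChange_adj_mul hω) hhS hind'
    (inclBaseChange_mem_skew hω x) (zero_mem _)
  have hle : W ≤ (LinearMap.ker (adBaseChange ω F x)).map (inclBaseChange ω F) := by
    intro w hw
    obtain ⟨hwS, hxw, -⟩ := hWmem w hw
    obtain ⟨y, rfl⟩ := exists_inclBaseChange_eq h2 hω halt hwS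
    refine ⟨y, ?_, rfl⟩
    apply inclBaseChange_injective
    rw [inclBaseChange_adBaseChange, hxw, sub_self, map_zero]
  refine hW.trans ((Submodule.finrank_mono hle).trans ?_)
  exact Submodule.finrank_map_le _ _

theorem le_natTrailingDegree_charpoly (h2 : (2 : K) ≠ 0) (hω : ω.Nondegenerate) (halt : ω.IsAlt)
    {n : ℕ} (hV : finrank K V = 2 * n) (x : F ⊗[K] sp ω) :
    n ≤ (adBaseChange ω F x).charpoly.natTrailingDegree := by
  rw [← LinearMap.finrank_maxGenEigenspace_zero_eq]
  refine (le_finrank_ker_adBaseChange h2 hω halt hV x).trans (Submodule.finrank_mono ?_)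
  intro y hy
  rw [Module.End.mem_maxGenEigenspace]
  exact ⟨1, by simpa using hy⟩

/-- Changing the signs of half of the entries moves a space of antisymmetric vectors to a disjoint
space of symmetric ones. -/
theorem two_mul_finrank_antisymmetric_le (h2 : (2 : F) ≠ 0) {m : ℕ} (hm : Even m)
    {P : Submodule F (Fin m → F)} (hP : ∀ c ∈ P, ∀ i, c (Fin.rev i) = - c i) :
    2 * finrank F P ≤ m := by
  have hrev : ∀ i : Fin m, Fin.rev i ≠ i := by
    intro i h
    have h1 := Fin.val_rev i
    rw [h] at h1
    rw [Nat.even_iff] at hm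
    omega
  let η : Fin m → F := fun i => if i < Fin.rev i then 1 else -1
  have hη : ∀ i, η i ≠ 0 := fun i => by
    simp only [η]
    split_ifs <;> simp
  have hηrev : ∀ i, η (Fin.rev i) = - η i := by
    intro i
    simp only [η, Fin.rev_rev]
    rcases lt_or_gt_of_ne (hrev i) with h | h
    · rw [if_pos h, if_neg h.not_gt, neg_neg]
    · rw [if_pos h, if_neg h.not_gt]
  let T : End F (Fin m → F) :=
    { toFun := fun c i => η i * c i
      map_add' := fun c c' => by ext p; simp [mul_add]
      map_smul' := fun r c => by ext p; simp [mul_left_comm] }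
  have hT : ∀ c i, T c i = η i * c i := fun _ _ => rfl
  conv_rhs => rw [← Module.finrank_fin_fun F (n := m)]
  refine two_mul_finrank_le_of_disjoint_map (T := T) (fun c c' h => ?_) fun c hc hTc => ?_
  · funext i
    have := congrFun h i
    rw [hT, hT] at this
    exact mul_left_cancel₀ (hη _) this
  · funext i
    have := hP _ hTc i
    rw [hT, hT, hP c hc, hηrev] at this
    have h3 : (2 * η i) * c i = 0 := by linear_combination this
    exact (mul_eq_zero.1 h3).resolve_left (mul_ne_zero h2 (hη i))

/-- A diagonal element of `F ⊗ sp(V)` with pairwise distinct eigenvalues on `F ⊗ V`; its adjoint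
action is semisimple with kernel the diagonal elements of `F ⊗ sp(V)`. -/
theorem exists_natTrailingDegree_charpoly_le (h2 : (2 : K) ≠ 0) (hω : ω.Nondegenerate)
    (halt : ω.IsAlt) {n : ℕ} (hV : finrank K V = 2 * n) {μ : Fin (2 * n) → F}
    (hμ : Function.Injective μ) (hμrev : ∀ i, μ (Fin.rev i) = - μ i) :
    ∃ x, (adBaseChange ω F x).charpoly.natTrailingDegree ≤ n := by
  classical
  obtain ⟨u, hu⟩ := exists_symplectic_basis hω halt hV
  have hur : ∀ i x, ω (u i) x = (-1) ^ (i : ℕ) * u.repr x (Fin.rev i) := by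
    intro i x
    conv_lhs => rw [← u.sum_repr x]
    rw [map_sum, Finset.sum_eq_single (Fin.rev i)]
    · rw [map_smul, hu, if_pos rfl, smul_eq_mul, mul_comm]
    · intro j _ hj
      rw [map_smul, hu, if_neg hj, smul_zero]
    · simp
  have hul : ∀ i x, ω x (u (Fin.rev i)) = u.repr x i * (-1) ^ (i : ℕ) := by
    intro i x
    conv_lhs => rw [← u.sum_repr x]
    rw [map_sum, LinearMap.sum_apply, Finset.sum_eq_single i]
    · rw [map_smul, LinearMap.smul_apply, hu, if_pos rfl, smul_eq_mul]
    · intro j _ hj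
      rw [map_smul, LinearMap.smul_apply, hu, if_neg fun h => hj (Fin.rev_injective h).symm,
        smul_zero]
    · simp
  -- the diagonal matrix units and the diagonal coefficients
  let E : Fin (2 * n) → End K V := fun i => (u.coord i).smulRight (u i)
  have hE : ∀ i v, E i v = u.repr v i • u i := fun i v => rfl
  have hEE : ∀ i j, E i * E j = if i = j then E i else 0 := by
    intro i j
    ext v
    rw [Module.End.mul_apply, hE j, map_smul, hE, Basis.repr_self, Finsupp.single_apply]
    by_cases h : i = j
    · subst h
      simp [hE]
    · simp [h, Ne.symm h]
  have hEsum : ∑ i, E i = 1 := by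
    ext v
    simp only [LinearMap.sum_apply, hE, u.sum_repr, Module.End.one_apply]
  have hEadj : ∀ i, adj hω (E i) = E (Fin.rev i) := by
    intro i
    rw [adj_eq_iff]
    intro v w
    rw [hE, hE, map_smul, map_smul, LinearMap.smul_apply, hur, Fin.rev_rev]
    have h1 := hul (Fin.rev i) v
    rw [Fin.rev_rev] at h1
    rw [h1, smul_eq_mul, smul_eq_mul]
    ring
  let cK : Fin (2 * n) → End K V →ₗ[K] K := fun i => u.coord i ∘ₗ LinearMap.applyₗ (u i)
  have hcK : ∀ i r, cK i r = u.repr (r (u i)) i := fun i r => rfl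
  have hEr : ∀ i r, E i * r * E i = cK i r • E i := by
    intro i r
    ext v
    rw [Module.End.mul_apply, Module.End.mul_apply, hE i v, map_smul, map_smul, hE,
      LinearMap.smul_apply, hE, hcK, smul_comm]
  have hcadj : ∀ i r, cK (Fin.rev i) (adj hω r) = cK i r := by
    intro i r
    have h1 := apply_adj_left hω r (u (Fin.rev i)) (u i)
    have h3 := hul (Fin.rev i) (adj hω r (u (Fin.rev i)))
    rw [Fin.rev_rev] at h3
    rw [h3, hur, Fin.rev_rev, mul_comm] at h1
    exact mul_left_cancel₀ (pow_ne_zero _ (neg_ne_zero.2 one_ne_zero)) h1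
  let E' : Fin (2 * n) → F ⊗[K] End K V := fun i => 1 ⊗ₜ E i
  let c : Fin (2 * n) → F ⊗[K] End K V →ₗ[F] F := fun i =>
    LinearMap.liftBaseChange F (Algebra.linearMap K F ∘ₗ cK i)
  have hc : ∀ i a r, c i (a ⊗ₜ r) = a * algebraMap K F (cK i r) := fun i a r => by
    simp [c]
  have hE'z : ∀ i z, E' i * z * E' i = c i z • E' i := by
    intro i z
    induction z using TensorProduct.induction_on with
    | zero => simp
    | add z z' hz hz' => rw [mul_add, add_mul, hz, hz', map_add, add_smul]
    | tmul a r =>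
      simp only [E', Algebra.TensorProduct.tmul_mul_tmul, one_mul, mul_one, hEr, hc]
      rw [tmul_smul, smul_tmul', smul_tmul', smul_eq_mul, mul_one, Algebra.smul_def, mul_comm]
  have hcadj' : ∀ i z, c (Fin.rev i) ((adj hω).baseChange F z) = c i z := by
    intro i z
    induction z using TensorProduct.induction_on with
    | zero => simp
    | add z z' hz hz' => rw [map_add, map_add, hz, hz', map_add]
    | tmul a r => rw [LinearMap.baseChange_tmul, hc, hc, hcadj]
  have hE'sum : ∑ i, E' i = 1 := by
    rw [← tmul_sum, hEsum, Algebra.TensorProduct.one_def]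
  set D : F ⊗[K] End K V := ∑ i, μ i • E' i with hD
  have hE'E' : ∀ i j, E' i * E' j = if i = j then E' i else 0 := by
    intro i j
    simp only [E', Algebra.TensorProduct.tmul_mul_tmul, one_mul, hEE]
    split_ifs <;> simp
  have hED : ∀ i, E' i * D = μ i • E' i := by
    intro i
    rw [hD, Finset.mul_sum, Finset.sum_eq_single i]
    · rw [mul_smul_comm, hE'E', if_pos rfl]
    · intro j _ hj
      rw [mul_smul_comm, hE'E', if_neg hj.symm, smul_zero]
    · simp
  have hDE : ∀ i, D * E' i = μ i • E' i := by
    intro i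
    rw [hD, Finset.sum_mul, Finset.sum_eq_single i]
    · rw [smul_mul_assoc, hE'E', if_pos rfl]
    · intro j _ hj
      rw [smul_mul_assoc, hE'E', if_neg hj, smul_zero]
    · simp
  have hDS : D ∈ skew ((adj hω).baseChange F) := by
    rw [mem_skew, hD, map_sum, ← Finset.sum_neg_distrib, ← Equiv.sum_comp Fin.revPerm]
    refine Finset.sum_congr rfl fun i _ => ?_
    rw [Fin.revPerm_apply, hμrev, map_smul, LinearMap.baseChange_tmul, hEadj, Fin.rev_rev,
      neg_smul]
  obtain ⟨x, hx⟩ := exists_inclBaseChange_eq h2 hω halt hDS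
  refine ⟨x, ?_⟩
  rw [← LinearMap.finrank_maxGenEigenspace_zero_eq]
  have hpow : ∀ i j y (N : ℕ), E' i * inclBaseChange ω F ((adBaseChange ω F x ^ N) y) * E' j =
      (μ i - μ j) ^ N • (E' i * inclBaseChange ω F y * E' j) := by
    intro i j y N
    induction N with
    | zero => simp
    | succ N ih =>
      rw [pow_succ', Module.End.mul_apply, inclBaseChange_adBaseChange, hx, mul_sub, sub_mul,
        ← mul_assoc, hED, ← mul_assoc (E' i), mul_assoc _ D, hDE, smul_mul_assoc, smul_mul_assoc,
        mul_smul_comm, ← sub_smul, ih, smul_smul, ← pow_succ']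
  have hoff : ∀ y ∈ (adBaseChange ω F x).maxGenEigenspace 0, ∀ i j, i ≠ j →
      E' i * inclBaseChange ω F y * E' j = 0 := by
    intro y hy i j hij
    obtain ⟨N, hN⟩ := (Module.End.mem_maxGenEigenspace _ _ _).1 hy
    rw [zero_smul, sub_zero] at hN
    have := hpow i j y N
    rw [hN, map_zero, mul_zero, zero_mul] at this
    exact (smul_eq_zero.1 this.symm).resolve_left
      (pow_ne_zero _ (sub_ne_zero.2 fun h => hij (hμ h)))
  let f : (adBaseChange ω F x).maxGenEigenspace 0 →ₗ[F] (Fin (2 * n) → F) :=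
    LinearMap.pi (fun i => c i ∘ₗ inclBaseChange ω F) ∘ₗ Submodule.subtype _
  have hf : Function.Injective f := by
    rw [← LinearMap.ker_eq_bot, LinearMap.ker_eq_bot']
    intro y hy
    have hall : ∀ i j, E' i * inclBaseChange ω F y * E' j = 0 := by
      intro i j
      by_cases hij : i = j
      · subst hij
        have : c i (inclBaseChange ω F y) = 0 := congrFun hy i
        rw [hE'z, this, zero_smul]
      · exact hoff y y.2 i j hij
    have hzero : inclBaseChange ω F y = 0 := by
      calc inclBaseChange ω F y
          = (∑ i, E' i) * inclBaseChange ω F y * ∑ j, E' j := by rw [hE'sum, one_mul, mul_one]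
        _ = 0 := by simp only [Finset.sum_mul, Finset.mul_sum, hall, Finset.sum_const_zero]
    exact Subtype.ext (inclBaseChange_injective (hzero.trans (map_zero _).symm))
  have h2F : (2 : F) ≠ 0 := by
    have := (map_ne_zero (algebraMap K F)).2 h2
    rwa [map_ofNat] at this
  have hle := two_mul_finrank_antisymmetric_le h2F (even_two_mul n) (P := LinearMap.range f) (by
    rintro _ ⟨y, rfl⟩ i
    have := hcadj' i (inclBaseChange ω F y)
    rw [mem_skew.1 (inclBaseChange_mem_skew hω _), map_neg] at this
    change c (Fin.rev i) (inclBaseChange ω F y) = - c i (inclBaseChange ω F y)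
    rw [← this, neg_neg])
  rw [LinearMap.finrank_range_of_inj hf] at hle
  omega

/-- Over the field of rational functions there are eigenvalues as needed for a regular diagonal
element of the symplectic Lie algebra. -/
theorem exists_injective_antisymmetric (h2 : (2 : K) ≠ 0) {m : ℕ} (hm : Even m) :
    ∃ μ : Fin m → RatFunc K, Function.Injective μ ∧ ∀ i, μ (Fin.rev i) = - μ i := by
  let ν : Fin m → Polynomial K := fun i => Polynomial.X ^ (i : ℕ) - Polynomial.X ^ (Fin.rev i : ℕ)
  refine ⟨fun i => algebraMap _ (RatFunc K) (ν i), fun i j hij => ?_, fun i => ?_⟩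
  · have h : ν i = ν j := RatFunc.algebraMap_injective K hij
    have hi := Fin.val_rev i
    have hj := Fin.val_rev j
    rw [Nat.even_iff] at hm
    have h1 := congrArg (fun p => Polynomial.coeff p i) h
    simp only [ν, Polynomial.coeff_sub, Polynomial.coeff_X_pow] at h1
    rw [if_pos trivial, if_neg (by omega)] at h1
    rw [Fin.ext_iff]
    by_contra hne
    rw [if_neg hne] at h1
    split_ifs at h1
    · exact h2 (by linear_combination h1)
    · simp at h1
  · simp only [ν]
    rw [Fin.rev_rev, ← map_neg, neg_sub]

theorem rank_sp (h2 : (2 : K) ≠ 0) (hω : ω.Nondegenerate) (halt : ω.IsAlt)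
    {n : ℕ} (hV : finrank K V = 2 * n) : LieAlgebra.rank K (sp ω) = n := by
  classical
  let b := Module.Free.chooseBasis K (sp ω)
  have hφ : ∀ (y : Module.Free.ChooseBasisIndex K (sp ω) → RatFunc K) (i : ℕ),
      MvPolynomial.aeval y ((LinearMap.polyCharpoly (LieAlgebra.ad K (sp ω)).toLinearMap b).coeff i)
        = (adBaseChange ω (RatFunc K) ((Algebra.TensorProduct.basis (RatFunc K) b).repr.symm
          (Finsupp.equivFunOnFinite.symm y))).charpoly.coeff i := by
    intro y i
    have := LinearMap.polyCharpolyAux_map_aeval (LieAlgebra.ad K (sp ω)).toLinearMap b b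
      (RatFunc K) y
    have := congrArg (fun p => Polynomial.coeff p i) this
    rw [Polynomial.coeff_map] at this
    exact this
  rw [LieAlgebra.rank_eq_natTrailingDegree K (sp ω) b]
  apply le_antisymm
  · obtain ⟨μ, hμ, hμrev⟩ := exists_injective_antisymmetric h2 (even_two_mul n)
    obtain ⟨x, hx⟩ := exists_natTrailingDegree_charpoly_le h2 hω halt hV hμ hμrev
    refine le_trans (Polynomial.natTrailingDegree_le_of_ne_zero fun h0 => ?_) hx
    have := hφ (Finsupp.equivFunOnFinite ((Algebra.TensorProduct.basis (RatFunc K) b).repr x))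
      (adBaseChange ω (RatFunc K) x).charpoly.natTrailingDegree
    rw [h0, map_zero, Equiv.symm_apply_apply, LinearEquiv.symm_apply_apply] at this
    exact Polynomial.trailingCoeff_nonzero_iff_nonzero.2 (LinearMap.charpoly_monic _).ne_zero
      this.symm
  · refine Polynomial.le_natTrailingDegree (LinearMap.polyCharpoly_ne_zero _ _) fun m hm => ?_
    have : Infinite (RatFunc K) := Infinite.of_injective _ (RatFunc.algebraMap_injective K)
    apply MvPolynomial.map_injective (algebraMap K (RatFunc K)) (algebraMap K (RatFunc K)).injective
    rw [map_zero]
    refine MvPolynomial.funext fun y => ?_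
    rw [MvPolynomial.eval_map, ← MvPolynomial.aeval_def, hφ, map_zero]
    exact Polynomial.coeff_eq_zero_of_lt_natTrailingDegree
      (hm.trans_le (le_natTrailingDegree_charpoly h2 hω halt hV _))

end Rank

end ClassicalIndex

theorem mainTheorem2 {K V : Type*} [Field K] (hK : ringChar K ≠ 2)
    [AddCommGroup V] [Module K V] [FiniteDimensional K V]
    (n : ℕ) (hV : Module.finrank K V = 2 * n)
    (ω : LinearMap.BilinForm K V) (hω_alt : ω.IsAlt) (hω_nondeg : ω.Nondegenerate)
    (e : ClassicalIndex.sp ω) (he : IsNilpotent (e : Module.End K V)) :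
    -- adapted generators of the Jordan blocks of `e` exist
    (∃ k : ℕ, Nonempty (ClassicalIndex.SymplecticJordanGenerators ω (e : Module.End K V) k)) ∧
    (∀ (k : ℕ) (J : ClassicalIndex.SymplecticJordanGenerators ω (e : Module.End K V) k),
      -- the stabiliser of the restricted covector
      (∀ a : Fin k → K, Function.Injective a → (∀ i, a i ≠ 0) →
        (∀ i, Odd (J.d i + 1) → a (J.pair i) = - a i) →
        (ClassicalIndex.coadjointStabilizer
              (ClassicalIndex.restrictCovector ω e (J.alpha a))).map
            ((ClassicalIndex.sp ω).incl.comp (ClassicalIndex.centralizer K e).incl) =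
          (ClassicalIndex.coadjointStabilizer (J.alpha a)).map
              (ClassicalIndex.centralizer K (e : Module.End K V)).incl ⊓
            ClassicalIndex.sp ω ∧
        Module.finrank K (ClassicalIndex.coadjointStabilizer
          (ClassicalIndex.restrictCovector ω e (J.alpha a))) = n) ∧
      -- the index of the centraliser, if the field has at least `k` elements
      ((k : Cardinal) ≤ Cardinal.mk K →
        ClassicalIndex.index K (ClassicalIndex.centralizer K e) = n)) ∧
    -- the rank of the symplectic algebra
    LieAlgebra.rank K (ClassicalIndex.sp ω) = n := by
  have h2 : (2 : K) ≠ 0 := Ring.two_ne_zero hK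
  refine ⟨ClassicalIndex.exists_symplecticJordanGenerators h2 hω_nondeg hω_alt e.2 he,
    fun k J => ⟨fun a ha ha0 hpair => ?_, fun hk => ?_⟩, ?_⟩
  · exact ⟨ClassicalIndex.map_stabilizer_restrictCovector J h2 hω_nondeg hω_alt hpair,
      ClassicalIndex.finrank_stabilizer_restrictCovector h2 hω_nondeg hω_alt hV J hpair
        (fun i j hij _ h => hij (ha h)) fun _ j _ => ha0 j⟩
  · exact ClassicalIndex.index_centralizer_eq h2 hω_nondeg hω_alt hV J hk
  · exact ClassicalIndex.rank_sp h2 hω_nondeg hω_alt hV
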